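/- Let $p$ be a prime, $G=(V,E)$ a finite simple connected graph and $\kappa\colon V\times V\to[0,1]$ a symmetric weight with $\kappa(v,w)=0$ if and only if $v,w$ are not adjacent. Let $d_E$ be the shortest-path distance of $G$ with edge lengths $\kappa$, and $\delta$ its subdominant ultrametric, i.e. the largest ultrametric on $V$ with $\delta\le d_E$. Fix $\alpha\ge 1$ and $\bullet\in\{\kappa,d_E,\delta\}$ and put, for $v\ne w$ in $V$, $k(v,w)=\bullet(v,w)^{-\alpha}$, except that $k(v,w)=0$ if $\bullet=\kappa$ and $v,w$ are not adjacent. Represent the vertices $v$ by pairwise disjoint discs $U_v\subset\mathbb Z_p$ of common radius $p^{-m}$ with $m\ge0$ an integer. Let $Z=\bigsqcup_{v}U_v$, with the restriction $dx$ of the normalised Haar measure of $\mathbb Z_p$, and for $x\in U_v$, $y\in U_w$ let $k_p(x,y)=|x-y|_p^{-\alpha}$ if $v=w$ and $k_p(x,y)=k(v,w)$ if $v\neq w$. Let $\mathcal D(Z)$ be the space of test functions, i.e. of locally constant functions $Z\to\mathbb C$; a distribution is a linear functional on $\mathcal D(Z)$. Let $$\mathcal H_\bullet u(x)=\int_Z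 k_p(x,y)\,(u(y)-u(x))\,dy\qquad(u\text{ locally constant}),$$ and denote by $\mathcal H_\bullet$ also its closures, as an unbounded operator, in $L^2(Z,dx)$ (complex functions) and in $C(Z,\mathbb R)$; spectrum and eigenfunctions are those of the closure in $L^2(Z,dx)$. Then the heat kernel of $\mathcal H_\bullet$ exists as a distribution and is unique: the closure in $C(Z,\mathbb R)$ generates a Feller semigroup $\exp(t\mathcal H_\bullet)$, $t\ge0$ (a strongly continuous semigroup of positive operators on $C(Z,\mathbb R)$ fixing the constants), and there is exactly one family of distributions $p(t,x,\cdot)$ $(t\ge0,\ x\in Z)$ such that $(\exp(t\mathcal H_\bullet)u)(x)=\int_Z p(t,x,y)u(y)\,dy$ for all real-valued $u\in\mathcal D(Z)$, where the right-hand side denotes the value of $p(t,x,\cdot)$ at $u$. Moreover $L^2(Z,dx)$ has an orthonormal basis consisting of eigenfunctions of $\mathcal H_\bullet$, and this basis can be chosen real-valued. For every orthonormal basis $(\psi_i)_{i\in I}$ of $L^2(Z,dx)$ such that $\mathcal H_\bullet\psi_i=\lambda_i\psi_i$ with $\lambda_i\in\mathbb R$, one has $\operatorname{Spec}(\mathcal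 H_\bullet)=\{\lambda_i\mid i\in I\}$, all $\lambda_i\le0$, each value is taken by only finitely many $\lambda_i$, the $\psi_i$ are (almost everywhere equal to) locally constant functions, and $$p(t,x,y)=\sum_{i\in I}e^{\lambda_i t}\,\psi_i(x)\,\overline{\psi_i(y)}\qquad(t\ge0,\ x,y\in Z),$$ i.e. the sum over the spectrum, counted with multiplicity, of $e^{\lambda t}\psi_\lambda(x)\overline{\psi_\lambda(y)}$. Here the sum converges (unconditionally) in the sense of distributions: for all $t\ge0$, $x\in Z$ and $u\in\mathcal D(Z)$, $$\int_Z p(t,x,y)u(y)\,dy=\sum_{i\in I}e^{\lambda_i t}\psi_i(x)\int_Z\overline{\psi_i(y)}\,u(y)\,dy .$$ For a real-valued basis this is $p(t,x,y)=\sum_\lambda e^{\lambda t}\psi_\lambda(x)\psi_\lambda(y)$. -/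

import Mathlib

open MeasureTheory Filter Topology
open scoped NNReal ComplexConjugate

noncomputable section

/-! ### Weighted graphs and their distances -/

/-- A simple connected graph on `V` with a (symmetric) weight `κ` taking values in `[0,1]` and
vanishing exactly off the edges. -/
structure EdgeWeightedGraph (V : Type*) where
  graph : SimpleGraph V
  connected : graph.Connected
  κ : V → V → ℝ
  κ_symm : ∀ v w, κ v w = κ w v
  κ_nonneg : ∀ v w, 0 ≤ κ v w
  κ_le_one : ∀ v w, κ v w ≤ 1
  κ_eq_zero_iff : ∀ v w, κ v w = 0 ↔ ¬ graph.Adj v w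

namespace EdgeWeightedGraph

variable {V : Type*} (G : EdgeWeightedGraph V)

/-- The total weight of a walk. -/
def walkLength {v w : V} (q : G.graph.Walk v w) : ℝ :=
  (q.darts.map fun d => G.κ d.fst d.snd).sum

/-- The shortest path distance `d_E` of the weighted graph. -/
def pathDist (v w : V) : ℝ :=
  ⨅ q : G.graph.Walk v w, G.walkLength q

/-- `ρ` is an ultrametric on `V`. -/
structure IsUltrametric {V : Type*} (ρ : V → V → ℝ) : Prop where
  eq_zero_iff : ∀ v w, ρ v w = 0 ↔ v = w
  symm : ∀ v w, ρ v w = ρ w v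
  le_max : ∀ u v w, ρ u w ≤ max (ρ u v) (ρ v w)

/-- The subdominant ultrametric `δ` of `d_E`: the pointwise largest ultrametric `≤ d_E`. -/
def subdominant (v w : V) : ℝ :=
  sSup {r | ∃ ρ : V → V → ℝ, IsUltrametric ρ ∧ (∀ a b, ρ a b ≤ G.pathDist a b) ∧ ρ v w = r}

end EdgeWeightedGraph

/-- The three interaction types `• ∈ {κ, d_E, δ}`. -/
inductive InteractionType
  | adjacency
  | pathDist
  | subdominant

/-- The kernel `k : V × V → ℝ` on vertices (only its off-diagonal values matter). -/
def EdgeWeightedGraph.vertexKernel {V : Type*} (G : EdgeWeightedGraph V) (α : ℝ) :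
    InteractionType → V → V → ℝ
  | .adjacency, v, w => open Classical in if G.graph.Adj v w then G.κ v w ^ (-α) else 0
  | .pathDist, v, w => G.pathDist v w ^ (-α)
  | .subdominant, v, w => G.subdominant v w ^ (-α)

/-! ### The `p`-adic domain -/

instance PadicInt.borelMeasurableSpace (p : ℕ) [Fact p.Prime] : MeasurableSpace ℤ_[p] :=
  borel ℤ_[p]

instance PadicInt.borelSpaceInst (p : ℕ) [Fact p.Prime] : BorelSpace ℤ_[p] := ⟨rfl⟩

/-- The Haar measure on `ℤ_p` with total mass `1`. -/
def padicHaar (p : ℕ) [Fact p.Prime] : Measure ℤ_[p] :=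
  Measure.addHaarMeasure (⊤ : TopologicalSpace.PositiveCompacts ℤ_[p])

/-- A representation of the vertices of a weighted graph by pairwise disjoint discs in `ℤ_p`
of common radius `p ^ (-m)`, `m ≥ 0`. -/
structure PadicGraph (p : ℕ) [Fact p.Prime] (V : Type*) extends EdgeWeightedGraph V where
  m : ℕ
  center : V → ℤ_[p]
  disjoint : ∀ v w, v ≠ w → Disjoint
    (Metric.closedBall (center v) ((p : ℝ) ^ (-(m : ℤ))))
    (Metric.closedBall (center w) ((p : ℝ) ^ (-(m : ℤ))))

namespace PadicGraph

variable {p : ℕ} [Fact p.Prime] {V : Type*} (D : PadicGraph p V)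

/-- The disc `U_v`. -/
def disc (v : V) : Set ℤ_[p] :=
  Metric.closedBall (D.center v) ((p : ℝ) ^ (-(D.m : ℤ)))

/-- The domain `Z`, the union of the discs `U_v`. -/
def carrier : Set ℤ_[p] := ⋃ v, D.disc v

/-- `Z` as a topological space. -/
abbrev Z : Type := D.carrier

/-- The vertex `v(x)` whose disc contains `x`. -/
def vertex (x : D.Z) : V := (Set.mem_iUnion.1 x.2).choose

/-- The Haar measure `dx` restricted to `Z`. -/
def haar : Measure D.Z := (padicHaar p).comap Subtype.val

/-- The kernel `k_p` on `Z × Z`. -/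
def kernel (α : ℝ) (b : InteractionType) (x y : D.Z) : ℝ :=
  open Classical in
  if D.vertex x = D.vertex y then ‖(x : ℤ_[p]) - y‖ ^ (-α)
  else D.vertexKernel α b (D.vertex x) (D.vertex y)

theorem mem_disc_vertex (x : D.Z) : (x : ℤ_[p]) ∈ D.disc (D.vertex x) :=
  (Set.mem_iUnion.1 x.2).choose_spec

theorem vertex_eq_iff (x : D.Z) (v : V) : D.vertex x = v ↔ (x : ℤ_[p]) ∈ D.disc v := by
  constructor
  · rintro rfl
    exact D.mem_disc_vertex x
  · intro h
    by_contra hne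
    exact Set.disjoint_left.1 (D.disjoint _ _ hne) (D.mem_disc_vertex x) h

theorem radius_ne_zero : ((p : ℝ) ^ (-(D.m : ℤ))) ≠ 0 :=
  zpow_ne_zero _ (by exact_mod_cast (Fact.out : p.Prime).ne_zero)

theorem isOpen_disc (v : V) : IsOpen (D.disc v) :=
  IsUltrametricDist.isOpen_closedBall _ D.radius_ne_zero

theorem isOpen_carrier : IsOpen D.carrier := isOpen_iUnion D.isOpen_disc

theorem isLocallyConstant_vertex : IsLocallyConstant D.vertex := by
  rw [IsLocallyConstant.iff_isOpen_fiber]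
  intro v
  have : {x | D.vertex x = v} = (Subtype.val : D.Z → ℤ_[p]) ⁻¹' D.disc v := by
    ext x
    exact D.vertex_eq_iff x v
  change IsOpen {x | D.vertex x = v}
  rw [this]
  exact (D.isOpen_disc v).preimage continuous_subtype_val

instance compactSpace_Z [Finite V] : CompactSpace D.Z :=
  isCompact_iff_compactSpace.1
    (isClosed_iUnion_of_finite fun _ => Metric.isClosed_closedBall).isCompact

instance isFiniteMeasure_haar : IsFiniteMeasure D.haar := by
  refine ⟨?_⟩
  rw [haar, comap_subtype_coe_apply D.isOpen_carrier.measurableSet]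
  refine (measure_mono (Set.subset_univ _)).trans_lt ?_
  rw [padicHaar]
  exact isCompact_univ.measure_lt_top

instance isOpenPosMeasure_haar : D.haar.IsOpenPosMeasure := by
  refine ⟨fun U hU hne => ?_⟩
  rw [haar, comap_subtype_coe_apply D.isOpen_carrier.measurableSet, padicHaar]
  exact ((D.isOpen_carrier.isOpenMap_subtype_val U hU).measure_pos _ (hne.image _)).ne'

/-- The kernel does not distinguish nearby points when seen from far away. -/
theorem kernel_congr (α : ℝ) (b : InteractionType) {x x' y : D.Z}
    (hv : D.vertex x = D.vertex x') (hd : dist x x' < dist x' y) :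
    D.kernel α b x y = D.kernel α b x' y := by
  have h : ‖(x : ℤ_[p]) - y‖ = ‖(x' : ℤ_[p]) - y‖ := by
    have h1 : ‖(x : ℤ_[p]) - x'‖ < ‖(x' : ℤ_[p]) - y‖ := by
      simpa [Subtype.dist_eq, dist_eq_norm] using hd
    have h2 := IsUltrametricDist.norm_add_eq_max_of_norm_ne_norm h1.ne
    rw [max_eq_right h1.le] at h2
    simpa using h2
  rw [kernel, kernel, hv, h]

theorem kernel_congr_right (α : ℝ) (b : InteractionType) {x y y' : D.Z}
    (hv : D.vertex y = D.vertex y') (hd : dist y y' < dist y' x) :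
    D.kernel α b x y = D.kernel α b x y' := by
  have h : ‖(x : ℤ_[p]) - y‖ = ‖(x : ℤ_[p]) - y'‖ := by
    have h1 : ‖(y : ℤ_[p]) - y'‖ < ‖(y' : ℤ_[p]) - x‖ := by
      simpa [Subtype.dist_eq, dist_eq_norm] using hd
    have h2 := IsUltrametricDist.norm_add_eq_max_of_norm_ne_norm h1.ne
    rw [max_eq_right h1.le] at h2
    rw [norm_sub_rev, norm_sub_rev (x : ℤ_[p])]
    simpa using h2
  rw [kernel, kernel, hv, h]

section Operator

variable {𝕜 : Type*} [RCLike 𝕜] (α : ℝ) (b : InteractionType)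

theorem isLocallyConstant_integrand (u : LocallyConstant D.Z 𝕜) (x : D.Z) :
    IsLocallyConstant fun y => D.kernel α b x y • (u y - u x) := by
  rw [IsLocallyConstant.iff_eventually_eq]
  intro y₀
  by_cases hxy : y₀ = x
  · subst hxy
    filter_upwards [u.isLocallyConstant.eventually_eq y₀] with y hy
    rw [LocallyConstant.toFun_eq_coe] at hy
    simp [hy]
  · filter_upwards [u.isLocallyConstant.eventually_eq y₀,
      D.isLocallyConstant_vertex.eventually_eq y₀,
      Metric.ball_mem_nhds y₀ (dist_pos.2 hxy)] with y hy hv hd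
    rw [LocallyConstant.toFun_eq_coe] at hy
    rw [hy, D.kernel_congr_right α b hv hd]

theorem integrable_integrand [Finite V] (u : LocallyConstant D.Z 𝕜) (x : D.Z) :
    Integrable (fun y => D.kernel α b x y • (u y - u x)) D.haar :=
  (D.isLocallyConstant_integrand α b u x).continuous.integrable_of_hasCompactSupport
    (HasCompactSupport.of_compactSpace _)

theorem isLocallyConstant_apply (u : LocallyConstant D.Z 𝕜) :
    IsLocallyConstant fun x => ∫ y, D.kernel α b x y • (u y - u x) ∂D.haar := by
  rw [IsLocallyConstant.iff_eventually_eq]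
  intro x₀
  obtain ⟨ε, hε, hball⟩ := Metric.eventually_nhds_iff.1 (u.isLocallyConstant.eventually_eq x₀)
  rw [LocallyConstant.toFun_eq_coe] at hball
  filter_upwards [D.isLocallyConstant_vertex.eventually_eq x₀, Metric.ball_mem_nhds x₀ hε]
    with x hv hx
  congr 1
  funext y
  rw [hball hx]
  by_cases hy : dist y x₀ < ε
  · simp [hball hy]
  · rw [D.kernel_congr α b hv (lt_of_lt_of_le hx (by rw [dist_comm x₀]; exact not_lt.1 hy))]

variable (𝕜) in
/-- The hierarchical Parisi operator on test functions,
`(𝓗 u)(x) = ∫_Z k_p(x,y) (u(y) - u(x)) dy`. -/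
def parisi [Finite V] : LocallyConstant D.Z 𝕜 →ₗ[𝕜] LocallyConstant D.Z 𝕜 where
  toFun u := ⟨fun x => ∫ y, D.kernel α b x y • (u y - u x) ∂D.haar,
    D.isLocallyConstant_apply α b u⟩
  map_add' u w := by
    ext x
    change ∫ y, D.kernel α b x y • ((u + w) y - (u + w) x) ∂D.haar = _ + _
    refine Eq.trans ?_ (integral_add (D.integrable_integrand α b u x)
      (D.integrable_integrand α b w x))
    congr 1
    funext y
    rw [LocallyConstant.add_apply, LocallyConstant.add_apply, ← smul_add]
    congr 1
    ring
  map_smul' c u := by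
    ext x
    change ∫ y, D.kernel α b x y • ((c • u) y - (c • u) x) ∂D.haar = c • _
    refine Eq.trans ?_ (integral_smul c _)
    congr 1
    funext y
    rw [LocallyConstant.smul_apply, LocallyConstant.smul_apply, ← smul_sub, smul_comm]

end Operator

end PadicGraph

/-- The partially defined operator on `E` with domain `ι(S)` given by `ι s ↦ ι (A s)`. -/
def LinearPMap.ofInjective {𝕜 S E : Type*} [Field 𝕜] [AddCommGroup S] [Module 𝕜 S]
    [AddCommGroup E] [Module 𝕜 E] (ι : S →ₗ[𝕜] E) (hι : Function.Injective ι) (A : S →ₗ[𝕜] S) :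
    E →ₗ.[𝕜] E where
  domain := LinearMap.range ι
  toFun := ι ∘ₗ A ∘ₗ (LinearEquiv.ofInjective ι hι).symm.toLinearMap

namespace PadicGraph

variable {p : ℕ} [Fact p.Prime] {V : Type*} [Finite V] (D : PadicGraph p V)

/-- The Hilbert space `L²(Z, dx)`. -/
abbrev L2 : Type := Lp ℂ 2 D.haar

/-- Test functions as elements of `L²(Z, dx)`. -/
def toL2 : LocallyConstant D.Z ℂ →ₗ[ℂ] D.L2 :=
  (ContinuousMap.toLp 2 D.haar ℂ : C(D.Z, ℂ) →L[ℂ] D.L2).toLinearMap ∘ₗ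
    LocallyConstant.toContinuousMapLinearMap ℂ

/-- Test functions as elements of `C(Z, ℝ)`. -/
def toC : LocallyConstant D.Z ℝ →ₗ[ℝ] C(D.Z, ℝ) :=
  LocallyConstant.toContinuousMapLinearMap ℝ

theorem toL2_injective : Function.Injective D.toL2 :=
  (ContinuousMap.toLp_injective D.haar).comp LocallyConstant.toContinuousMap_injective

/-- `𝓗` as an unbounded operator on `L²(Z, dx)`: the closure of its restriction to the
test functions. -/
def parisiL2 (α : ℝ) (b : InteractionType) : D.L2 →ₗ.[ℂ] D.L2 :=
  (LinearPMap.ofInjective D.toL2 D.toL2_injective (D.parisi ℂ α b)).closure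

/-- `𝓗` as an unbounded operator on `C(Z, ℝ)`: the closure of its restriction to the
test functions. -/
def parisiC (α : ℝ) (b : InteractionType) : C(D.Z, ℝ) →ₗ.[ℝ] C(D.Z, ℝ) :=
  (LinearPMap.ofInjective D.toC LocallyConstant.toContinuousMap_injective (D.parisi ℝ α b)).closure

end PadicGraph

/-! ### Spectra and semigroups -/

/-- `z` lies in the resolvent set of `A`: `z - A` has a bounded two-sided inverse. -/
def LinearPMap.IsResolventPoint {E : Type*} [NormedAddCommGroup E] [NormedSpace ℂ E]
    (A : E →ₗ.[ℂ] E) (z : ℂ) : Prop :=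
  ∃ R : E →L[ℂ] E,
    (∀ f : E, ∃ h : R f ∈ A.domain, z • R f - A ⟨R f, h⟩ = f) ∧
    ∀ g : A.domain, R (z • (g : E) - A g) = g

/-- The spectrum of an unbounded operator. -/
def LinearPMap.spec {E : Type*} [NormedAddCommGroup E] [NormedSpace ℂ E]
    (A : E →ₗ.[ℂ] E) : Set ℂ :=
  {z | ¬ A.IsResolventPoint z}

/-- The Hilbert basis `e` consists of eigenvectors of `A`, with eigenvalues `ev`. -/
def IsEigenbasis {E ι : Type*} [NormedAddCommGroup E] [InnerProductSpace ℂ E]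
    (A : E →ₗ.[ℂ] E) (e : HilbertBasis ι ℂ E) (ev : ι → ℝ) : Prop :=
  ∀ i, ∃ h : e i ∈ A.domain, A ⟨e i, h⟩ = (ev i : ℂ) • e i

/-- A (conservative) Feller semigroup on a compact space: a strongly continuous semigroup of
positive operators on `C(X, ℝ)` preserving the constants (in particular, contractions). -/
structure IsFellerSemigroup {X : Type*} [TopologicalSpace X] [CompactSpace X]
    (T : ℝ≥0 → C(X, ℝ) →L[ℝ] C(X, ℝ)) : Prop where
  zero : T 0 = ContinuousLinearMap.id ℝ _
  add : ∀ s t, T (s + t) = (T s).comp (T t)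
  tendsto_zero : ∀ u, Tendsto (fun t => T t u) (𝓝 0) (𝓝 u)
  nonneg : ∀ t u, 0 ≤ u → 0 ≤ T t u
  one : ∀ t, T t 1 = 1

/-- `A` is the infinitesimal generator of the semigroup `T`, i.e. `T t = exp (t A)`. -/
def IsGenerator {E : Type*} [NormedAddCommGroup E] [NormedSpace ℝ E]
    (A : E →ₗ.[ℝ] E) (T : ℝ≥0 → E →L[ℝ] E) : Prop :=
  ∀ u w : E, (u, w) ∈ A.graph ↔
    Tendsto (fun t : ℝ≥0 => (t : ℝ)⁻¹ • (T t u - u)) (𝓝[>] 0) (𝓝 w)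

namespace PadicGraph

variable {p : ℕ} [Fact p.Prime] {V : Type*} (D : PadicGraph p V)

/-- Distributions on `Z`: linear functionals on the test functions, i.e. on the (complex valued)
locally constant functions. No continuity has to be required, as usual over `ℚ_p`. -/
abbrev Distribution : Type := LocallyConstant D.Z ℂ →ₗ[ℂ] ℂ

/-- A real test function as a complex one. -/
def complexify (u : LocallyConstant D.Z ℝ) : LocallyConstant D.Z ℂ :=
  u.map Complex.ofReal

/-- `K` is the heat kernel of `𝓗` in the sense of distributions: `𝓗` generates a Feller semigroup
`exp (t 𝓗)` on `C(Z, ℝ)`, and the distributions `K t x = p(t, x, ·)` satisfy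
`(exp (t 𝓗) u)(x) = ∫_Z p(t, x, y) u(y) dy` for all test functions `u`. By linearity it suffices
to test against real valued `u`. -/
def IsHeatKernel [Finite V] (α : ℝ) (b : InteractionType) (K : ℝ≥0 → D.Z → D.Distribution) :
    Prop :=
  ∃ T : ℝ≥0 → C(D.Z, ℝ) →L[ℝ] C(D.Z, ℝ),
    IsFellerSemigroup T ∧ IsGenerator (D.parisiC α b) T ∧
    ∀ (t : ℝ≥0) (x : D.Z) (u : LocallyConstant D.Z ℝ),
      K t x (D.complexify u) = ((T t (D.toC u) x : ℝ) : ℂ)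

end PadicGraph

end

/-! ### Elementary properties of the kernel -/

namespace EdgeWeightedGraph

variable {V : Type*} (G : EdgeWeightedGraph V)

/-! Everything reduces to an algebraic diagonalisation of the operator on real test functions. Let
`D.level n` be the functions constant on balls of radius p^(-n), with n ≥ m. Such a function sees
the kernel only at distances above p^(-n), and there, by the ultrametric inequality, the kernel is
itself constant on such balls. So each level is a finite-dimensional invariant space. The levels
exhaust the test functions (`exists_mem_level`), and the operator is symmetric for the L² pairing
(`integral_parisi_mul`). The spectral theorem on each level gives an orthonormal family of locally
constant eigenfunctions spanning all test functions.

Eigenvalues are controlled from two sides. The maximum principle gives dissipativity in the sup norm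
(`norm_le_norm_sub_smul_parisi`), so they are ≤ 0. An eigenfunction constant at scale p^(-(n+1)) but
not at p^(-n) has eigenvalue at most minus the kernel mass beyond p^(-n). For α ≥ 1 this mass grows
at least linearly in n, so only finitely many eigenvalues, with multiplicity, lie above any bound
(`mem_level_of_eigenvalue_ge`).

On C(Z, ℝ), dissipativity makes the resolvents contractions, hence also the heat operators, as
limits of powers of resolvents (`tendsto_resolvent_pow`). They extend by density to a Feller
semigroup whose generator is the closure. Any other Feller semigroup with this generator multiplies
each eigenfunction by exp(λt), hence agrees with it on test functions (`eq_heat_of_isGenerator`).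

On L² the closure acts diagonally in the eigenbasis, so its spectrum is the set of eigenvalues. The
vectors of any other eigenbasis are finite combinations of eigenfunctions with the same eigenvalue.
Tested against one eigenfunction, the heat kernel expansion is therefore a finite sum, and linearity
gives it for all test functions. -/

theorem walkLength_nonneg {v w : V} (q : G.graph.Walk v w) : 0 ≤ G.walkLength q := by
  refine List.sum_nonneg fun r hr => ?_
  obtain ⟨d, -, rfl⟩ := List.mem_map.1 hr
  exact G.κ_nonneg _ _

theorem walkLength_reverse {v w : V} (q : G.graph.Walk v w) :
    G.walkLength q.reverse = G.walkLength q := by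
  simp only [walkLength, SimpleGraph.Walk.darts_reverse, List.map_reverse, List.sum_reverse,
    List.map_map]
  congr 2
  funext d
  exact G.κ_symm _ _

theorem pathDist_nonneg (v w : V) : 0 ≤ G.pathDist v w :=
  Real.iInf_nonneg fun q => G.walkLength_nonneg q

theorem pathDist_symm (v w : V) : G.pathDist v w = G.pathDist w v :=
  Equiv.iInf_congr ⟨SimpleGraph.Walk.reverse, SimpleGraph.Walk.reverse,
    SimpleGraph.Walk.reverse_reverse, SimpleGraph.Walk.reverse_reverse⟩
    fun q => G.walkLength_reverse q

/-- Compare ρ(v,v) = 0 with the maximum of ρ(v,w) and ρ(w,v), which are equal. -/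
theorem IsUltrametric.nonneg {ρ : V → V → ℝ} (h : IsUltrametric ρ) (v w : V) : 0 ≤ ρ v w := by
  simpa [(h.eq_zero_iff v v).2 rfl, h.symm w v] using h.le_max v w v

theorem subdominant_nonneg (v w : V) : 0 ≤ G.subdominant v w := by
  refine Real.sSup_nonneg ?_
  rintro r ⟨ρ, h, -, rfl⟩
  exact h.nonneg v w

theorem subdominant_symm (v w : V) : G.subdominant v w = G.subdominant w v := by
  unfold subdominant
  congr 1
  ext r
  exact exists_congr fun ρ => and_congr_right fun h => by rw [h.symm v w]

/-- Nonnegativity and symmetry are all that the argument needs from the three interaction types; the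
growth of the spectrum comes from the kernel inside the discs. -/
theorem vertexKernel_nonneg (α : ℝ) (b : InteractionType) (v w : V) :
    0 ≤ G.vertexKernel α b v w := by
  cases b
  · simp only [vertexKernel]
    split_ifs
    · exact Real.rpow_nonneg (G.κ_nonneg v w) _
    · exact le_rfl
  · exact Real.rpow_nonneg (G.pathDist_nonneg v w) _
  · exact Real.rpow_nonneg (G.subdominant_nonneg v w) _

theorem vertexKernel_symm (α : ℝ) (b : InteractionType) (v w : V) :
    G.vertexKernel α b v w = G.vertexKernel α b w v := by
  cases b
  · by_cases h : G.graph.Adj v w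
    · simp [vertexKernel, h, h.symm, G.κ_symm v w]
    · simp [vertexKernel, h, mt SimpleGraph.Adj.symm h]
  · simp only [vertexKernel, G.pathDist_symm v w]
  · simp only [vertexKernel, G.subdominant_symm v w]

end EdgeWeightedGraph

/-- The radius `p ^ (-n)`. -/
noncomputable def padicRadius (p n : ℕ) : ℝ := (p : ℝ) ^ (-(n : ℤ))

/-! ### Haar measure of p-adic balls -/

section padicRadius

variable (p : ℕ) [hp : Fact p.Prime]

theorem padicRadius_pos (n : ℕ) : 0 < padicRadius p n :=
  zpow_pos (by exact_mod_cast hp.out.pos) _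

theorem padicRadius_anti {m n : ℕ} (h : m ≤ n) : padicRadius p n ≤ padicRadius p m :=
  zpow_le_zpow_right₀ (by exact_mod_cast hp.out.one_lt.le) (by simpa using h)

theorem tendsto_padicRadius : Tendsto (padicRadius p) atTop (𝓝 0) := by
  have h : padicRadius p = fun n : ℕ => ((p : ℝ)⁻¹) ^ n := by
    funext n
    simp [padicRadius]
  rw [h]
  exact tendsto_pow_atTop_nhds_zero_of_lt_one (by positivity)
    (inv_lt_one_of_one_lt₀ (by exact_mod_cast hp.out.one_lt))

theorem padicInt_closedBall (n : ℕ) :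
    Metric.closedBall (0 : ℤ_[p]) (padicRadius p n) =
      ((PadicInt.toZModPow n : ℤ_[p] →+* ZMod (p ^ n)).toAddMonoidHom.ker : Set ℤ_[p]) := by
  ext x
  have h : x ∈ RingHom.ker (PadicInt.toZModPow n : ℤ_[p] →+* ZMod (p ^ n)) ↔
      ‖x‖ ≤ padicRadius p n := by
    rw [PadicInt.ker_toZModPow, ← PadicInt.norm_le_pow_iff_mem_span_pow]
    rfl
  rw [mem_closedBall_zero_iff, ← h]
  rfl

theorem padicHaar_univ : padicHaar p Set.univ = 1 := by
  have := Measure.addHaarMeasure_self (K₀ := (⊤ : TopologicalSpace.PositiveCompacts ℤ_[p]))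
  simpa [padicHaar] using this

instance : (padicHaar p).IsAddHaarMeasure := by
  unfold padicHaar
  infer_instance

/-- The ball is a translate of the kernel of reduction modulo p^n, a subgroup of index p^n in a
group of total mass 1. -/
theorem padicHaar_closedBall (x : ℤ_[p]) (n : ℕ) :
    padicHaar p (Metric.closedBall x (padicRadius p n)) = ENNReal.ofReal (padicRadius p n) := by
  have hx : Metric.closedBall x (padicRadius p n) =
      (fun y => -x + y) ⁻¹' Metric.closedBall 0 (padicRadius p n) := by
    ext y
    simp [dist_eq_norm, neg_add_eq_sub]
  rw [hx, measure_preimage_add]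
  have : NeZero (p ^ n) := ⟨pow_ne_zero _ hp.out.ne_zero⟩
  set H := (PadicInt.toZModPow n : ℤ_[p] →+* ZMod (p ^ n)).toAddMonoidHom.ker with hH
  have hindex : H.index = p ^ n := by
    rw [hH, AddSubgroup.index_ker]
    have : Function.Surjective (PadicInt.toZModPow n : ℤ_[p] →+* ZMod (p ^ n)) :=
      ZMod.ringHom_surjective _
    rw [AddMonoidHom.range_eq_top.2 this]
    simp
  have : H.FiniteIndex := ⟨by rw [hindex]; exact NeZero.ne _⟩
  have hmeas : MeasurableSet (H : Set ℤ_[p]) := by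
    rw [hH, ← padicInt_closedBall]
    exact Metric.isClosed_closedBall.measurableSet
  have h := AddSubgroup.index_mul_measure H hmeas (padicHaar p)
  rw [padicHaar_univ, hindex, hH, ← padicInt_closedBall] at h
  have hpow : ENNReal.ofReal (padicRadius p n) = ((p ^ n : ℕ) : ENNReal)⁻¹ := by
    rw [padicRadius, zpow_neg, zpow_natCast, ENNReal.ofReal_inv_of_pos
      (pow_pos (by exact_mod_cast hp.out.pos) _)]
    congr 1
    rw [← Nat.cast_pow, ENNReal.ofReal_natCast]
  rw [hpow]
  exact ENNReal.eq_inv_of_mul_eq_one_left (by rwa [mul_comm])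

end padicRadius

/-! ### Truncated kernels and the filtration of test functions by level -/

noncomputable section

namespace PadicGraph

variable {p : ℕ} [Fact p.Prime] {V : Type*} (D : PadicGraph p V) (α : ℝ) (b : InteractionType)

theorem kernel_nonneg (x y : D.Z) : 0 ≤ D.kernel α b x y := by
  unfold kernel
  split_ifs
  · positivity
  · exact D.vertexKernel_nonneg α b _ _

theorem kernel_symm (x y : D.Z) : D.kernel α b x y = D.kernel α b y x := by
  by_cases h : D.vertex x = D.vertex y
  · rw [kernel, kernel, if_pos h, if_pos h.symm, norm_sub_rev]
  · rw [kernel, kernel, if_neg h, if_neg (Ne.symm h), D.vertexKernel_symm α b]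

theorem vertex_eq_of_dist_le {n : ℕ} (hn : D.m ≤ n) {x y : D.Z}
    (h : dist x y ≤ padicRadius p n) : D.vertex x = D.vertex y := by
  rw [D.vertex_eq_iff]
  refine (dist_triangle_max (x : ℤ_[p]) y (D.center (D.vertex y))).trans (max_le ?_ ?_)
  · exact h.trans (padicRadius_anti p hn)
  · exact D.mem_disc_vertex y

theorem disc_eq_closedBall (x : D.Z) :
    D.disc (D.vertex x) = Metric.closedBall (x : ℤ_[p]) (padicRadius p D.m) :=
  (IsUltrametricDist.closedBall_eq_of_mem (D.mem_disc_vertex x))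

theorem haar_closedBall (x : D.Z) {n : ℕ} (hn : D.m ≤ n) :
    D.haar.real (Metric.closedBall x (padicRadius p n)) = padicRadius p n := by
  have himage : Subtype.val '' Metric.closedBall x (padicRadius p n) =
      Metric.closedBall (x : ℤ_[p]) (padicRadius p n) := by
    ext y
    constructor
    · rintro ⟨y, hy, rfl⟩
      exact hy
    · intro hy
      refine ⟨⟨y, Set.mem_iUnion.2 ⟨D.vertex x, ?_⟩⟩, hy, rfl⟩
      rw [disc_eq_closedBall]
      exact Metric.closedBall_subset_closedBall (padicRadius_anti p hn) hy
  rw [Measure.real, haar, comap_subtype_coe_apply D.isOpen_carrier.measurableSet, himage,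
    padicHaar_closedBall, ENNReal.toReal_ofReal (padicRadius_pos p n).le]

open Classical in
/-- The kernel truncated to zero at distances at most `p ^ (-n)`. -/
def truncKernel (n : ℕ) (x y : D.Z) : ℝ :=
  if dist x y ≤ padicRadius p n then 0 else D.kernel α b x y

theorem truncKernel_nonneg (n : ℕ) (x y : D.Z) : 0 ≤ D.truncKernel α b n x y := by
  unfold truncKernel
  split_ifs
  · exact le_rfl
  · exact D.kernel_nonneg α b x y

theorem truncKernel_symm (n : ℕ) (x y : D.Z) :
    D.truncKernel α b n x y = D.truncKernel α b n y x := by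
  rw [truncKernel, truncKernel, dist_comm, D.kernel_symm]

theorem dist_le_iff_of_dist_le {X : Type*} [PseudoMetricSpace X] [IsUltrametricDist X] {x x' y : X}
    {r : ℝ} (h : dist x x' ≤ r) : dist x y ≤ r ↔ dist x' y ≤ r :=
  ⟨fun h' => (dist_triangle_max x' x y).trans (max_le (by rwa [dist_comm]) h'),
    fun h' => (dist_triangle_max x x' y).trans (max_le h h')⟩

instance : IsUltrametricDist D.Z := ⟨fun x y z => dist_triangle_max (x : ℤ_[p]) y z⟩

/-- A point y within p^(-n) of one of x, x' is within p^(-n) of both and is cut off for both; a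
farther y has the same distance to both. -/
theorem truncKernel_congr {n : ℕ} (hn : D.m ≤ n) {x x' : D.Z} (h : dist x x' ≤ padicRadius p n)
    (y : D.Z) : D.truncKernel α b n x y = D.truncKernel α b n x' y := by
  by_cases hy : dist x' y ≤ padicRadius p n
  · rw [truncKernel, truncKernel, if_pos hy, if_pos ((dist_le_iff_of_dist_le h).2 hy)]
  · rw [truncKernel, truncKernel, if_neg hy, if_neg (mt (dist_le_iff_of_dist_le h).1 hy)]
    exact D.kernel_congr α b (D.vertex_eq_of_dist_le hn h) (h.trans_lt (not_le.1 hy))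

theorem continuous_truncKernel {n : ℕ} (hn : D.m ≤ n) :
    Continuous fun z : D.Z × D.Z => D.truncKernel α b n z.1 z.2 := by
  refine IsLocallyConstant.continuous ?_
  rw [IsLocallyConstant.iff_eventually_eq]
  rintro ⟨x, y⟩
  filter_upwards [prod_mem_nhds (Metric.closedBall_mem_nhds x (padicRadius_pos p n))
    (Metric.closedBall_mem_nhds y (padicRadius_pos p n))] with z hz
  rw [D.truncKernel_congr α b hn hz.1, D.truncKernel_symm, D.truncKernel_congr α b hn hz.2,
    D.truncKernel_symm]

theorem isLocallyConstant_of_dist_le {β : Type*} {n : ℕ} {f : D.Z → β}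
    (h : ∀ x y, dist x y ≤ padicRadius p n → f x = f y) : IsLocallyConstant f := by
  rw [IsLocallyConstant.iff_eventually_eq]
  intro x
  filter_upwards [Metric.closedBall_mem_nhds x (padicRadius_pos p n)] with y hy
  exact h y x hy

/-- The test functions which are constant on all discs of radius `p ^ (-n)`. -/
def level (n : ℕ) : Submodule ℝ (LocallyConstant D.Z ℝ) where
  carrier := {u | ∀ x y, dist x y ≤ padicRadius p n → u x = u y}
  add_mem' hu hv x y h := by simp [hu x y h, hv x y h]
  zero_mem' _ _ _ := rfl
  smul_mem' c u hu x y h := by simp [hu x y h]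

theorem level_mono {m n : ℕ} (h : m ≤ n) : D.level m ≤ D.level n :=
  fun _ hu x y hxy => hu x y (hxy.trans (padicRadius_anti p h))

theorem continuous_truncKernel_right {n : ℕ} (hn : D.m ≤ n) (x : D.Z) :
    Continuous fun y => D.truncKernel α b n x y :=
  (D.continuous_truncKernel α b hn).comp (Continuous.prodMk_right x)

/-- The total mass of the truncated kernel. -/
def truncMass (n : ℕ) (x : D.Z) : ℝ := ∫ y, D.truncKernel α b n x y ∂D.haar

theorem truncMass_nonneg (n : ℕ) (x : D.Z) : 0 ≤ D.truncMass α b n x :=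
  integral_nonneg fun y => D.truncKernel_nonneg α b n x y

theorem truncMass_congr {n : ℕ} (hn : D.m ≤ n) {x y : D.Z} (h : dist x y ≤ padicRadius p n) :
    D.truncMass α b n x = D.truncMass α b n y := by
  simp only [truncMass, D.truncKernel_congr α b hn h]

theorem continuous_truncMass {n : ℕ} (hn : D.m ≤ n) : Continuous (D.truncMass α b n) :=
  (D.isLocallyConstant_of_dist_le fun _ _ h => D.truncMass_congr α b hn h).continuous

variable [Finite V]

/-- Local constancy is uniform by compactness: take p^(-n) below a Lebesgue number of the cover by
fibres. -/
theorem exists_mem_level (u : LocallyConstant D.Z ℝ) : ∃ n, D.m ≤ n ∧ u ∈ D.level n := by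
  obtain ⟨δ, hδ, h⟩ := lebesgue_number_lemma_of_metric (isCompact_univ (X := D.Z))
    (c := fun r : ℝ => u ⁻¹' {r}) (fun r => u.isLocallyConstant _)
    (fun x _ => Set.mem_iUnion.2 ⟨u x, rfl⟩)
  obtain ⟨n, hn, hn'⟩ := ((tendsto_padicRadius p).eventually_lt_const hδ |>.and
    (eventually_ge_atTop D.m)).exists
  refine ⟨n, hn', fun x y hxy => ?_⟩
  obtain ⟨r, hr⟩ := h x trivial
  have h1 : u x = r := hr (Metric.mem_ball_self hδ)
  have h2 : u y = r := hr (by rw [Metric.mem_ball, dist_comm]; exact hxy.trans_lt hn)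
  rw [h1, h2]

/-- Evaluation at the centres of a finite cover by balls of radius p^(-n) is injective. -/
instance finiteDimensional_level (n : ℕ) : FiniteDimensional ℝ (D.level n) := by
  obtain ⟨s, -, hs, hcover⟩ := (isCompact_univ (X := D.Z)).finite_cover_balls (padicRadius_pos p n)
  have := hs.to_subtype
  let f : D.level n →ₗ[ℝ] (s → ℝ) :=
    { toFun := fun u x => u.1 x
      map_add' := fun _ _ => rfl
      map_smul' := fun _ _ => rfl }
  refine Module.Finite.of_injective f fun u v huv => Subtype.ext (LocallyConstant.ext fun x => ?_)
  obtain ⟨y, hy, hxy⟩ := Set.mem_iUnion₂.1 (hcover (Set.mem_univ x))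
  have hxy' : dist x y ≤ padicRadius p n := le_of_lt hxy
  rw [u.2 x y hxy', v.2 x y hxy']
  exact congrFun huv ⟨y, hy⟩

variable {D} in
theorem parisi_apply {𝕜 : Type*} [RCLike 𝕜] (u : LocallyConstant D.Z 𝕜) (x : D.Z) :
    D.parisi 𝕜 α b u x = ∫ y, D.kernel α b x y • (u y - u x) ∂D.haar := rfl

theorem _root_.Continuous.integrable_of_compactSpace {X : Type*} [TopologicalSpace X]
    [CompactSpace X] [MeasurableSpace X] [OpensMeasurableSpace X] {E : Type*}
    [NormedAddCommGroup E] {f : X → E} (hf : Continuous f) (μ : Measure X)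
    [IsFiniteMeasure μ] [SecondCountableTopologyEither X E] : Integrable f μ :=
  hf.integrable_of_hasCompactSupport (HasCompactSupport.of_compactSpace _)

/-- On the ball where the cut-off acts, u y - u x already vanishes. The singular kernel may thus be
replaced by a bounded one. -/
theorem parisi_apply_of_mem_level {n : ℕ} {u : LocallyConstant D.Z ℝ} (hu : u ∈ D.level n)
    (x : D.Z) :
    D.parisi ℝ α b u x = ∫ y, D.truncKernel α b n x y * (u y - u x) ∂D.haar := by
  rw [parisi_apply]
  congr 1
  funext y
  rw [truncKernel]
  split_ifs with h
  · simp [hu x y h]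
  · rfl

theorem parisi_mem_level {n : ℕ} (hn : D.m ≤ n) {u : LocallyConstant D.Z ℝ} (hu : u ∈ D.level n) :
    D.parisi ℝ α b u ∈ D.level n := by
  intro x y hxy
  rw [D.parisi_apply_of_mem_level α b hu, D.parisi_apply_of_mem_level α b hu, hu x y hxy]
  simp only [D.truncKernel_congr α b hn hxy]

end PadicGraph

end

/-! ### Growth of the kernel mass, symmetry and the maximum principle -/

noncomputable section

namespace PadicGraph

variable {p : ℕ} [Fact p.Prime] {V : Type*} (D : PadicGraph p V) (α : ℝ) (b : InteractionType)

/-- Nonzero p-adic distances are powers of p, so the two bounds force the distance to be exactly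
p^(-q); both points lie in one disc since q ≥ m. -/
theorem kernel_eq_of_dist_eq {q : ℕ} (hq : D.m ≤ q) {x y : D.Z} (h : dist x y ≤ padicRadius p q)
    (h' : ¬ dist x y ≤ padicRadius p (q + 1)) :
    D.kernel α b x y = padicRadius p q ^ (-α) := by
  rw [kernel, if_pos (D.vertex_eq_of_dist_le hq h)]
  have hd : dist x y = ‖(x : ℤ_[p]) - y‖ := by rw [Subtype.dist_eq, dist_eq_norm]
  rw [hd] at h h'
  congr 1
  refine le_antisymm h (not_lt.1 fun hlt => h' ?_)
  refine (PadicInt.norm_le_pow_iff_norm_lt_pow_add_one _ _).2 ?_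
  simpa [padicRadius] using hlt

/-- The two truncations differ only on the shell of points at distance p^(-q), where the kernel is
constant. -/
theorem truncKernel_succ_eq {q : ℕ} (hq : D.m ≤ q) (x y : D.Z) :
    D.truncKernel α b (q + 1) x y = D.truncKernel α b q x y + padicRadius p q ^ (-α) *
      ((Metric.closedBall x (padicRadius p q)).indicator 1 y -
        (Metric.closedBall x (padicRadius p (q + 1))).indicator 1 y) := by
  simp only [truncKernel, Set.indicator, Metric.mem_closedBall, dist_comm y x, Pi.one_apply]
  by_cases h : dist x y ≤ padicRadius p q
  · by_cases h' : dist x y ≤ padicRadius p (q + 1)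
    · simp [h, h']
    · simp [h, h', D.kernel_eq_of_dist_eq α b hq h h']
  · have h' : ¬ dist x y ≤ padicRadius p (q + 1) :=
      fun h' => h (h'.trans (padicRadius_anti p q.le_succ))
    simp [h, h']

theorem nonempty_Z : Nonempty D.Z :=
  ⟨⟨D.center (D.connected.nonempty.some), Set.mem_iUnion.2 ⟨_,
    Metric.mem_closedBall_self (padicRadius_pos p D.m).le⟩⟩⟩

variable [Finite V]

theorem integrable_truncKernel_mul {n : ℕ} (hn : D.m ≤ n) (x : D.Z) {u : D.Z → ℝ}
    (hu : Continuous u) : Integrable (fun y => D.truncKernel α b n x y * u y) D.haar :=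
  ((D.continuous_truncKernel_right α b hn x).mul hu).integrable_of_compactSpace _

theorem integrable_truncKernel {n : ℕ} (hn : D.m ≤ n) (x : D.Z) :
    Integrable (fun y => D.truncKernel α b n x y) D.haar :=
  (D.continuous_truncKernel_right α b hn x).integrable_of_compactSpace _

theorem truncMass_succ {q : ℕ} (hq : D.m ≤ q) (x : D.Z) :
    D.truncMass α b (q + 1) x = D.truncMass α b q x +
      padicRadius p q ^ (-α) * (padicRadius p q - padicRadius p (q + 1)) := by
  have hi : ∀ r, Integrable ((Metric.closedBall x r).indicator (1 : D.Z → ℝ)) D.haar := fun r =>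
    (integrable_const (1 : ℝ)).indicator Metric.isClosed_closedBall.measurableSet
  have hd : Integrable (fun y => padicRadius p q ^ (-α) *
      ((Metric.closedBall x (padicRadius p q)).indicator (1 : D.Z → ℝ) y -
        (Metric.closedBall x (padicRadius p (q + 1))).indicator 1 y)) D.haar :=
    ((hi _).sub (hi _)).const_mul _
  simp only [truncMass, D.truncKernel_succ_eq α b hq]
  rw [integral_add (D.integrable_truncKernel α b hq x) hd,
    integral_const_mul, integral_sub (hi _) (hi _),
    integral_indicator_one Metric.isClosed_closedBall.measurableSet,
    integral_indicator_one Metric.isClosed_closedBall.measurableSet,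
    D.haar_closedBall x hq, D.haar_closedBall x (hq.trans q.le_succ)]

/-- This is the mass of one shell, and the place where α ≥ 1 enters. With r = p^(-q) ≤ 1 one has
r^(-α) ≥ r⁻¹, so the product is at least 1 - 1/p ≥ 1/2. -/
theorem half_le_truncMass_sub (hα : 1 ≤ α) (q : ℕ) :
    1 / 2 ≤ padicRadius p q ^ (-α) * (padicRadius p q - padicRadius p (q + 1)) := by
  have hp : (2 : ℝ) ≤ p := by exact_mod_cast (Fact.out : p.Prime).two_le
  have hr := padicRadius_pos p q
  have hr1 : padicRadius p q ≤ 1 := by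
    simpa [padicRadius] using padicRadius_anti p (Nat.zero_le q)
  have hs : padicRadius p (q + 1) = padicRadius p q * (p : ℝ)⁻¹ := by
    rw [padicRadius, padicRadius, ← zpow_sub_one₀ (by positivity)]
    congr 1
    push_cast
    ring
  have h1 : (padicRadius p q)⁻¹ ≤ padicRadius p q ^ (-α) := by
    rw [← Real.rpow_neg_one]
    exact Real.rpow_le_rpow_of_exponent_ge hr hr1 (by linarith)
  have h2 : (p : ℝ)⁻¹ ≤ 1 / 2 := by
    rw [inv_le_comm₀ (by positivity) (by norm_num)]
    linarith
  calc (1 : ℝ) / 2 ≤ 1 - (p : ℝ)⁻¹ := by linarith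
    _ = (padicRadius p q)⁻¹ * (padicRadius p q - padicRadius p (q + 1)) := by
      rw [hs]
      field_simp
    _ ≤ _ := mul_le_mul_of_nonneg_right h1 (sub_nonneg.2 (padicRadius_anti p q.le_succ))

theorem le_truncMass (hα : 1 ≤ α) {q : ℕ} (hq : D.m ≤ q) (x : D.Z) :
    ((q : ℝ) - D.m) / 2 ≤ D.truncMass α b q x := by
  induction q, hq using Nat.le_induction with
  | base => simpa using D.truncMass_nonneg α b _ x
  | succ q hq ih =>
    rw [D.truncMass_succ α b hq]
    have := half_le_truncMass_sub (p := p) α hα q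
    push_cast
    linarith

theorem parisi_apply_eq_sub {n : ℕ} (hn : D.m ≤ n) {u : LocallyConstant D.Z ℝ}
    (hu : u ∈ D.level n) (x : D.Z) :
    D.parisi ℝ α b u x =
      ∫ y, D.truncKernel α b n x y * u y ∂D.haar - D.truncMass α b n x * u x := by
  rw [D.parisi_apply_of_mem_level α b hu, truncMass, ← integral_mul_const, ← integral_sub]
  · simp only [mul_sub]
  · exact D.integrable_truncKernel_mul α b hn x u.continuous
  · exact (D.integrable_truncKernel α b hn x).mul_const _

/-- Eigenfunctions with small eigenvalues are constant on large discs. -/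
theorem mem_level_of_eigenvalue_ge (hα : 1 ≤ α) {q : ℕ} (hq : D.m ≤ q) {μ : ℝ}
    (hμ : -(((q : ℝ) - D.m) / 2) ≤ μ) {u : LocallyConstant D.Z ℝ}
    (hu : D.parisi ℝ α b u = μ • u) : u ∈ D.level q := by
  obtain ⟨n, hn, hun⟩ := D.exists_mem_level u
  -- The level of u is lowered from n + 1 to n, one step at a time, down to q.
  suffices h : ∀ n, q ≤ n → u ∈ D.level n → u ∈ D.level q from
    h (max q n) (le_max_left _ _) (D.level_mono (le_max_right _ _) hun)
  intro n hqn
  induction n, hqn using Nat.le_induction with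
  | base => exact id
  | succ n hqn ih =>
    intro hu'
    refine ih fun x₁ x₂ hx => ?_
    by_contra hne
    have hmn := hq.trans hqn
    set B := Metric.closedBall x₁ (padicRadius p n)
    have hB : MeasurableSet B := Metric.isClosed_closedBall.measurableSet
    set w : ℝ := padicRadius p n ^ (-α)
    -- The eigenvalue equation on a ball B of radius p^(-n). Both integrals on the right are
    -- independent of x ∈ B, so x enters only through u x; subtracting the equations at two points
    -- of B isolates the scalar factor.
    have key : ∀ x ∈ B, μ * u x = ∫ y, D.truncKernel α b n x₁ y * u y ∂D.haar
        - D.truncMass α b n x₁ * u x + w * ∫ y in B, u y ∂D.haar - w * D.haar.real B * u x := by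
      intro x hx
      have hx' : dist x x₁ ≤ padicRadius p n := hx
      have hball : Metric.closedBall x (padicRadius p n) = B :=
        (IsUltrametricDist.closedBall_eq_of_mem hx).symm
      have h1 : D.parisi ℝ α b u x = μ * u x := by rw [hu]; rfl
      rw [← h1, D.parisi_apply_of_mem_level α b hu']
      have h2 : ∀ y, D.truncKernel α b (n + 1) x y * (u y - u x) =
          D.truncKernel α b n x₁ y * u y - D.truncKernel α b n x₁ y * u x
            + (w * B.indicator u y - w * u x * B.indicator 1 y) := by
        intro y
        rw [D.truncKernel_succ_eq α b hmn, hball, D.truncKernel_congr α b hmn hx']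
        by_cases hy : dist x y ≤ padicRadius p (n + 1)
        · have hyB : y ∈ B := by
            rw [← hball, Metric.mem_closedBall, dist_comm]
            exact hy.trans (padicRadius_anti p n.le_succ)
          simp [hu' x y hy, hyB]
        · have : (Metric.closedBall x (padicRadius p (n + 1))).indicator (1 : D.Z → ℝ) y = 0 := by
            rw [Set.indicator_of_notMem]
            rwa [Metric.mem_closedBall, dist_comm]
          rw [this]
          by_cases hyB : y ∈ B
          · simp only [hyB, Set.indicator_of_mem, Pi.one_apply, w]
            ring
          · simp only [hyB, not_false_eq_true, Set.indicator_of_notMem]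
            ring
      have i1 := D.integrable_truncKernel_mul α b hmn x₁ u.continuous
      have i2 : Integrable (fun y => D.truncKernel α b n x₁ y * u x) D.haar :=
        (D.integrable_truncKernel α b hmn x₁).mul_const _
      have i3 : Integrable (fun y => w * B.indicator u y) D.haar :=
        ((u.continuous.integrable_of_compactSpace _).indicator hB).const_mul _
      have i4 : Integrable (fun y => w * u x * B.indicator 1 y) D.haar :=
        ((integrable_const (1 : ℝ)).indicator hB).const_mul _
      have i5 : Integrable (fun y => D.truncKernel α b n x₁ y * u y -
        D.truncKernel α b n x₁ y * u x) D.haar := i1.sub i2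
      have i6 : Integrable (fun y => w * B.indicator u y - w * u x * B.indicator 1 y) D.haar :=
        i3.sub i4
      simp only [h2]
      rw [integral_add i5 i6, integral_sub i1 i2, integral_sub i3 i4,
        integral_mul_const, integral_const_mul, integral_const_mul, integral_indicator_one hB,
        integral_indicator hB, ← truncMass]
      ring
    have e1 := key x₁ (Metric.mem_closedBall_self (padicRadius_pos p n).le)
    have e2 := key x₂ (by rwa [Metric.mem_closedBall, dist_comm])
    have e3 : (μ + D.truncMass α b n x₁ + w * D.haar.real B) * (u x₁ - u x₂) = 0 := by
      linear_combination e1 - e2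
    rcases mul_eq_zero.1 e3 with h | h
    -- The factor is strictly positive: the mass is at least (n - m)/2 ≥ (q - m)/2 ≥ -μ, and the
    -- contribution of B is positive.
    · have h4 := D.le_truncMass α b hα hmn x₁
      have h5 : (q : ℝ) ≤ n := by exact_mod_cast hqn
      have h6 : 0 < w * D.haar.real B :=
        mul_pos (Real.rpow_pos_of_pos (padicRadius_pos p n) _)
          (by rw [D.haar_closedBall x₁ hmn]; exact padicRadius_pos p n)
      linarith
    · exact hne (sub_eq_zero.1 h)

/-- At a common level of u and v the operator is integration against a continuous symmetric kernel
minus multiplication by its mass, so Fubini applies. -/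
theorem integral_parisi_mul (u v : LocallyConstant D.Z ℝ) :
    ∫ x, D.parisi ℝ α b u x * v x ∂D.haar = ∫ x, u x * D.parisi ℝ α b v x ∂D.haar := by
  obtain ⟨n₁, hn₁, hu⟩ := D.exists_mem_level u
  obtain ⟨n₂, -, hv⟩ := D.exists_mem_level v
  set n := max n₁ n₂
  have hn : D.m ≤ n := hn₁.trans (le_max_left _ _)
  replace hu := D.level_mono (le_max_left n₁ n₂) hu
  replace hv := D.level_mono (le_max_right n₁ n₂) hv
  have hcont : ∀ u v : LocallyConstant D.Z ℝ, Continuous fun z : D.Z × D.Z =>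
      D.truncKernel α b n z.1 z.2 * u z.2 * v z.1 := fun u v =>
    ((D.continuous_truncKernel α b hn).mul (u.continuous.comp continuous_snd)).mul
      (v.continuous.comp continuous_fst)
  have hint : ∀ u v : LocallyConstant D.Z ℝ, Integrable (fun x =>
      ∫ y, D.truncKernel α b n x y * u y * v x ∂D.haar) D.haar := fun u v =>
    ((hcont u v).integrable_of_compactSpace (D.haar.prod D.haar)).integral_prod_left
  have hmass : Integrable (fun x => D.truncMass α b n x * u x * v x) D.haar :=
    (((D.continuous_truncMass α b hn).mul u.continuous).mul v.continuous).integrable_of_compactSpace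
      _
  have hL : ∀ x, D.parisi ℝ α b u x * v x =
      ∫ y, D.truncKernel α b n x y * u y * v x ∂D.haar - D.truncMass α b n x * u x * v x := by
    intro x
    rw [D.parisi_apply_eq_sub α b hn hu, sub_mul, integral_mul_const]
  have hR : ∀ x, u x * D.parisi ℝ α b v x =
      ∫ y, D.truncKernel α b n x y * v y * u x ∂D.haar - D.truncMass α b n x * u x * v x := by
    intro x
    rw [D.parisi_apply_eq_sub α b hn hv, mul_sub, integral_mul_const]
    ring
  simp only [hL, hR]
  rw [integral_sub (hint u v) hmass, integral_sub (hint v u) hmass]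
  congr 1
  rw [integral_integral_swap ((hcont u v).integrable_of_compactSpace (D.haar.prod D.haar))]
  congr 1
  funext y
  congr 1
  funext x
  rw [D.truncKernel_symm]
  ring

/-- The maximum principle. -/
theorem parisi_apply_nonpos {u : LocallyConstant D.Z ℝ} {x : D.Z} (h : ∀ y, u y ≤ u x) :
    D.parisi ℝ α b u x ≤ 0 :=
  integral_nonpos fun y => mul_nonpos_of_nonneg_of_nonpos (D.kernel_nonneg α b x y)
    (sub_nonpos.2 (h y))

/-- Dissipativity. At a maximum point of |u|, after replacing u by -u if necessary, the operator
takes a value ≤ 0, so subtracting c times it cannot lower the value there. -/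
theorem norm_le_norm_sub_smul_parisi {c : ℝ} (hc : 0 ≤ c) (u : LocallyConstant D.Z ℝ) :
    ‖D.toC u‖ ≤ ‖D.toC (u - c • D.parisi ℝ α b u)‖ := by
  have := D.nonempty_Z
  obtain ⟨x, -, hx⟩ := isCompact_univ.exists_isMaxOn Set.univ_nonempty
    (D.toC u).continuous.norm.continuousOn
  have key : ∀ v : LocallyConstant D.Z ℝ, (∀ y, v y ≤ v x) →
      v x ≤ ‖D.toC (v - c • D.parisi ℝ α b v)‖ := by
    intro v hv
    have h1 := mul_nonpos_of_nonneg_of_nonpos hc (D.parisi_apply_nonpos α b hv)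
    have h2 := (D.toC (v - c • D.parisi ℝ α b v)).norm_coe_le_norm x
    have h3 := le_abs_self (D.toC (v - c • D.parisi ℝ α b v) x)
    have h4 : D.toC (v - c • D.parisi ℝ α b v) x = v x - c * D.parisi ℝ α b v x := rfl
    rw [Real.norm_eq_abs] at h2
    linarith
  rw [ContinuousMap.norm_le _ (norm_nonneg _)]
  intro y
  refine (hx (Set.mem_univ y)).trans ?_
  have hxy : ∀ y, |u y| ≤ |u x| := fun y => hx (Set.mem_univ y)
  change |u x| ≤ _
  rcases le_total 0 (u x) with h | h
  · rw [abs_of_nonneg h]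
    exact key u fun y => (le_abs_self _).trans ((hxy y).trans (abs_of_nonneg h).le)
  · rw [abs_of_nonpos h]
    have := key (-u) fun y => (neg_le_abs _).trans ((hxy y).trans (abs_of_nonpos h).le)
    rwa [map_neg, smul_neg, sub_neg_eq_add, neg_add_eq_sub, ← neg_sub u, map_neg D.toC, norm_neg] at this

theorem eigenvalue_nonpos {μ : ℝ} {u : LocallyConstant D.Z ℝ} (hu : D.parisi ℝ α b u = μ • u)
    (h0 : u ≠ 0) : μ ≤ 0 := by
  by_contra! hμ
  refine h0 (LocallyConstant.toContinuousMap_injective ?_)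
  -- The choice c = μ⁻¹ makes the right-hand side of the dissipativity estimate vanish.
  have h := D.norm_le_norm_sub_smul_parisi α b (inv_nonneg.2 hμ.le) u
  rw [hu, smul_smul, inv_mul_cancel₀ hμ.ne', one_smul, sub_self, map_zero, norm_zero] at h
  exact (norm_le_zero_iff.1 h).trans (map_zero D.toC).symm

end PadicGraph

end

/-! ### Existence of a complete orthonormal system of eigenfunctions -/

noncomputable section

/-- A symmetric operator which locally acts on finite dimensional invariant subspaces, and whose
eigenspaces are finite dimensional, has an algebraic orthonormal basis of eigenvectors. -/
theorem LinearMap.IsSymmetric.exists_orthonormal_eigenvectors {S : Type*} [NormedAddCommGroup S]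
    [InnerProductSpace ℝ S] {H : S →ₗ[ℝ] S} (hH : H.IsSymmetric)
    (hloc : ∀ u, ∃ W : Submodule ℝ S, FiniteDimensional ℝ W ∧ u ∈ W ∧ ∀ w ∈ W, H w ∈ W)
    (hfin : ∀ μ, FiniteDimensional ℝ (Module.End.eigenspace H μ)) :
    ∃ (ι : Type) (ψ : ι → S) (ev : ι → ℝ), (∀ i, H (ψ i) = ev i • ψ i) ∧ Orthonormal ℝ ψ ∧
      Submodule.span ℝ (Set.range ψ) = ⊤ := by
  let e := fun μ : ℝ => stdOrthonormalBasis ℝ (Module.End.eigenspace H μ)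
  refine ⟨Σ μ : ℝ, Fin (Module.finrank ℝ (Module.End.eigenspace H μ)),
    fun i => (e i.1 i.2 : S), fun i => i.1, fun i => ?_, ?_, ?_⟩
  · exact Module.End.mem_eigenspace_iff.1 (e i.1 i.2).2
  · exact hH.orthogonalFamily_eigenspaces.orthonormal_sigma_orthonormal
      fun μ => (e μ).orthonormal
  · set P := Submodule.span ℝ (Set.range fun i :
      Σ μ : ℝ, Fin (Module.finrank ℝ (Module.End.eigenspace H μ)) => (e i.1 i.2 : S))
    have hP : ∀ μ, Module.End.eigenspace H μ ≤ P := by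
      intro μ u hu
      have h1 : (⟨u, hu⟩ : Module.End.eigenspace H μ) ∈ Submodule.span ℝ (Set.range (e μ)) := by
        rw [← OrthonormalBasis.coe_toBasis, (e μ).toBasis.span_eq]
        trivial
      have h2 := Submodule.mem_map_of_mem (f := (Module.End.eigenspace H μ).subtype) h1
      rw [Submodule.map_span] at h2
      refine Submodule.span_mono ?_ h2
      rintro _ ⟨_, ⟨i, rfl⟩, rfl⟩
      exact ⟨⟨μ, i⟩, rfl⟩
    rw [eq_top_iff]
    intro u _
    obtain ⟨W, hW, hu, hHW⟩ := hloc u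
    have hsymm := hH.restrict_invariant hHW
    -- The finite-dimensional spectral theorem on W: eigenvectors of the restriction span W, and
    -- they are eigenvectors of H.
    have htop : (⨆ μ : ℝ, Module.End.eigenspace (H.restrict hHW) μ) = ⊤ := by
      have h := hsymm.orthogonalComplement_iSup_eigenspaces_eq_bot
      rwa [Submodule.orthogonal_eq_bot_iff] at h
    have hle : (⨆ μ : ℝ, Module.End.eigenspace (H.restrict hHW) μ) ≤ P.comap W.subtype := by
      refine iSup_le fun μ w hw => hP μ ?_
      rw [Module.End.mem_eigenspace_iff] at hw ⊢
      exact congrArg Subtype.val hw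
    rw [htop] at hle
    exact hle (Submodule.mem_top (x := ⟨u, hu⟩))

namespace PadicGraph

variable {p : ℕ} [Fact p.Prime] {V : Type*} [Finite V] (D : PadicGraph p V) (α : ℝ)
  (b : InteractionType)

/-- The `L²` inner product of real test functions. -/
abbrev innerCore : InnerProductSpace.Core ℝ (LocallyConstant D.Z ℝ) where
  inner u v := ∫ x, u x * v x ∂D.haar
  conj_inner_symm u v := by
    change ∫ x, v x * u x ∂D.haar = ∫ x, u x * v x ∂D.haar
    simp only [mul_comm]
  re_inner_nonneg u := integral_nonneg fun x => mul_self_nonneg (u x)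
  add_left u v w := by
    change ∫ x, (u x + v x) * w x ∂D.haar = _ + _
    simp only [add_mul]
    exact integral_add ((u.continuous.mul w.continuous).integrable_of_compactSpace _)
      ((v.continuous.mul w.continuous).integrable_of_compactSpace _)
  smul_left u v r := by
    change ∫ x, (r * u x) * v x ∂D.haar = r * ∫ x, u x * v x ∂D.haar
    simp only [mul_assoc, integral_const_mul]
  definite u hu := by
    have hcont : Continuous fun x => u x * u x := u.continuous.mul u.continuous
    by_contra hne
    obtain ⟨x, hx⟩ : ∃ x, u x ≠ 0 := by
      by_contra! h0
      exact hne (LocallyConstant.ext h0)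
    exact (hcont.integral_pos_of_hasCompactSupport_nonneg_nonzero (μ := D.haar)
      (HasCompactSupport.of_compactSpace _) (fun x => mul_self_nonneg (u x))
      (mul_self_ne_zero.2 hx)).ne' hu

/-- An algebraic basis of the real test functions, consisting of orthonormal eigenfunctions, with
eigenvalues tending to `-∞`. -/
structure EigenSystem (ι : Type) where
  ψ : ι → LocallyConstant D.Z ℝ
  ev : ι → ℝ
  parisi_ψ : ∀ i, D.parisi ℝ α b (ψ i) = ev i • ψ i
  integral_self : ∀ i, ∫ x, ψ i x * ψ i x ∂D.haar = 1
  integral_ne : ∀ i j, i ≠ j → ∫ x, ψ i x * ψ j x ∂D.haar = 0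
  span_eq_top : Submodule.span ℝ (Set.range ψ) = ⊤
  ev_nonpos : ∀ i, ev i ≤ 0
  finite_ge : ∀ c, {i | c ≤ ev i}.Finite

theorem exists_eigenSystem (hα : 1 ≤ α) : ∃ ι, Nonempty (D.EigenSystem α b ι) := by
  let c := D.innerCore
  let := c.toNormedAddCommGroup
  let := InnerProductSpace.ofCore c.toCore
  -- All eigenfunctions with eigenvalue ≥ c lie in one level, q = m + k with k ≥ -2c. This gives
  -- both finite-dimensional eigenspaces and finiteness of the eigenvalues above c.
  have hlev : ∀ c : ℝ, ∃ q, ∀ μ, c ≤ μ → ∀ u, D.parisi ℝ α b u = μ • u → u ∈ D.level q := by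
    intro c
    obtain ⟨k, hk⟩ := exists_nat_ge (2 * -c)
    refine ⟨D.m + k, fun μ hμ u hu => D.mem_level_of_eigenvalue_ge α b hα
      (Nat.le_add_right _ _) ?_ hu⟩
    push_cast
    linarith
  obtain ⟨ι, ψ, ev, h1, h2, h3⟩ :=
    LinearMap.IsSymmetric.exists_orthonormal_eigenvectors (H := D.parisi ℝ α b)
      (fun u v => D.integral_parisi_mul α b u v)
      (fun u => by
        obtain ⟨n, hn, hu⟩ := D.exists_mem_level u
        exact ⟨D.level n, inferInstance, hu, fun w hw => D.parisi_mem_level α b hn hw⟩)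
      (fun μ => by
        obtain ⟨q, hq⟩ := hlev μ
        have hle : Module.End.eigenspace (D.parisi ℝ α b) μ ≤ D.level q := fun u hu =>
          hq μ le_rfl u (Module.End.mem_eigenspace_iff.1 hu)
        exact Submodule.finiteDimensional_of_le hle)
  refine ⟨ι, ⟨⟨ψ, ev, h1, fun i => ?_, fun i j hij => h2.2 hij, h3, fun i => ?_, fun c => ?_⟩⟩⟩
  · exact (real_inner_self_eq_norm_sq (ψ i)).trans (by rw [h2.1 i, one_pow])
  · exact D.eigenvalue_nonpos α b (h1 i) (h2.ne_zero i)
  · obtain ⟨q, hq⟩ := hlev c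
    have hli : LinearIndependent ℝ fun i : {i | c ≤ ev i} =>
        (⟨ψ i, hq (ev i) i.2 _ (h1 i)⟩ : D.level q) :=
      LinearIndependent.of_comp (D.level q).subtype
        (h2.linearIndependent.comp _ Subtype.val_injective)
    have := hli.finite
    exact Set.toFinite _

end PadicGraph

end

/-! ### Functional calculus and the heat semigroup on C(Z, ℝ) -/

noncomputable section

namespace PadicGraph

variable {p : ℕ} [Fact p.Prime] {V : Type*} [Finite V] (D : PadicGraph p V)

theorem denseRange_toC : DenseRange D.toC := by
  have h := ContinuousMap.subalgebra_topologicalClosure_eq_top_of_separatesPoints _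
    (LocallyConstant.separatesPoints_range_toContinuousMapAlgHom (X := D.Z) (Y := ℝ) ℝ)
  rw [DenseRange, dense_iff_closure_eq]
  exact congrArg (fun A : Subalgebra ℝ C(D.Z, ℝ) => (A : Set C(D.Z, ℝ))) h

variable {D} {α : ℝ} {b : InteractionType} {ι : Type}

namespace EigenSystem

variable (S : D.EigenSystem α b ι)

theorem linearIndependent : LinearIndependent ℝ S.ψ := by
  let c := D.innerCore
  let := c.toNormedAddCommGroup
  let := InnerProductSpace.ofCore c.toCore
  exact linearIndependent_of_ne_zero_of_inner_eq_zero
    (fun i h => by simpa [h] using S.integral_self i) (fun i j hij => S.integral_ne i j hij)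

/-- The eigenfunctions as an algebraic basis of the real test functions. -/
def basis : Module.Basis ι ℝ (LocallyConstant D.Z ℝ) :=
  Module.Basis.mk S.linearIndependent S.span_eq_top.ge

@[simp]
theorem basis_apply (i : ι) : S.basis i = S.ψ i := Module.Basis.mk_apply _ _ i

/-- The operator on test functions acting diagonally on the eigenfunctions. -/
def diag (f : ι → ℝ) : LocallyConstant D.Z ℝ →ₗ[ℝ] LocallyConstant D.Z ℝ :=
  S.basis.constr ℝ fun i => f i • S.ψ i

@[simp]
theorem diag_ψ (f : ι → ℝ) (i : ι) : S.diag f (S.ψ i) = f i • S.ψ i := by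
  rw [diag, ← S.basis_apply, S.basis.constr_basis, S.basis_apply]

theorem linearMap_ext {M : Type*} [AddCommGroup M] [Module ℝ M]
    {f g : LocallyConstant D.Z ℝ →ₗ[ℝ] M} (h : ∀ i, f (S.ψ i) = g (S.ψ i)) : f = g :=
  S.basis.ext fun i => by simpa using h i

theorem induction {P : LocallyConstant D.Z ℝ → Prop} (hψ : ∀ i, P (S.ψ i))
    (hadd : ∀ u v, P u → P v → P (u + v)) (hsmul : ∀ (c : ℝ) u, P u → P (c • u))
    (u : LocallyConstant D.Z ℝ) : P u := by
  -- Nontriviality makes the index set nonempty; P 0 is then obtained by scaling some eigenfunction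
  -- by 0.
  obtain ⟨x⟩ := D.nonempty_Z
  have : Nontrivial (LocallyConstant D.Z ℝ) :=
    ⟨0, 1, fun h => zero_ne_one (congrArg (fun v => v x) h)⟩
  have hu : u ∈ Submodule.span ℝ (Set.range S.ψ) := by rw [S.span_eq_top]; trivial
  induction hu using Submodule.span_induction with
  | mem x hx =>
    obtain ⟨i, rfl⟩ := hx
    exact hψ i
  | zero => simpa using hsmul 0 _ (hψ (S.basis.index_nonempty.some))
  | add u v _ _ hu hv => exact hadd u v hu hv
  | smul c u _ hu => exact hsmul c u hu

theorem parisi_eq_diag : D.parisi ℝ α b = S.diag S.ev :=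
  S.linearMap_ext fun i => by rw [S.parisi_ψ, diag_ψ]

theorem diag_mul (f g : ι → ℝ) (u : LocallyConstant D.Z ℝ) :
    S.diag f (S.diag g u) = S.diag (f * g) u := by
  have : S.diag f ∘ₗ S.diag g = S.diag (f * g) := S.linearMap_ext fun i => by
    simp [smul_smul, mul_comm]
  exact LinearMap.congr_fun this u

theorem diag_one (u : LocallyConstant D.Z ℝ) : S.diag 1 u = u := by
  have : S.diag 1 = LinearMap.id := S.linearMap_ext fun i => by simp
  exact LinearMap.congr_fun this u

/-- An eigenvector for μ has coordinates only at indices with eigenvalue μ. This covers eigenvectors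
outside the chosen basis, notably the constant 1. -/
theorem diag_comp_apply_of_eigenvector (F : ℝ → ℝ) {μ : ℝ} {u : LocallyConstant D.Z ℝ}
    (hu : D.parisi ℝ α b u = μ • u) : S.diag (F ∘ S.ev) u = F μ • u := by
  classical
  have hrepr : ∀ (f : ι → ℝ) v i, S.basis.repr (S.diag f v) i = f i * S.basis.repr v i := by
    intro f v i
    have : (S.basis.coord i) ∘ₗ S.diag f = f i • S.basis.coord i := S.linearMap_ext fun j => by
      rw [LinearMap.comp_apply, diag_ψ, map_smul, LinearMap.smul_apply, ← S.basis_apply,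
        Module.Basis.coord_apply, S.basis.repr_self, Finsupp.single_apply]
      split_ifs with h
      · rw [h]
      · simp
    exact LinearMap.congr_fun this v
  refine S.basis.repr.injective (Finsupp.ext fun i => ?_)
  rw [hrepr, map_smul, Finsupp.smul_apply, smul_eq_mul]
  have h := congrArg (fun v => S.basis.repr v i) hu
  simp only [S.parisi_eq_diag, hrepr, map_smul, Finsupp.smul_apply, smul_eq_mul] at h
  rcases mul_eq_mul_right_iff.1 h with h | h
  · simp [h]
  · simp [h]

/-- The resolvent `(1 - h 𝓗)⁻¹` on test functions. -/
def resolvent (h : ℝ) : LocallyConstant D.Z ℝ →ₗ[ℝ] LocallyConstant D.Z ℝ :=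
  S.diag fun i => (1 - h * S.ev i)⁻¹

theorem resolvent_sub {h : ℝ} (hh : 0 ≤ h) (u : LocallyConstant D.Z ℝ) :
    S.resolvent h u - h • D.parisi ℝ α b (S.resolvent h u) = u := by
  have : S.resolvent h - h • (D.parisi ℝ α b ∘ₗ S.resolvent h) = LinearMap.id :=
    S.linearMap_ext fun i => by
      have h1 : 1 - h * S.ev i ≠ 0 := by nlinarith [S.ev_nonpos i]
      simp only [resolvent, LinearMap.sub_apply, diag_ψ, LinearMap.smul_apply,
        LinearMap.comp_apply, map_smul, S.parisi_ψ, smul_smul, ← sub_smul, LinearMap.id_apply]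
      rw [show (1 - h * S.ev i)⁻¹ - h * ((1 - h * S.ev i)⁻¹ * S.ev i) = 1 by field_simp, one_smul]
  exact LinearMap.congr_fun this u

theorem norm_resolvent_le {h : ℝ} (hh : 0 ≤ h) (u : LocallyConstant D.Z ℝ) :
    ‖D.toC (S.resolvent h u)‖ ≤ ‖D.toC u‖ := by
  have := D.norm_le_norm_sub_smul_parisi α b hh (S.resolvent h u)
  rwa [S.resolvent_sub hh] at this

/-- The heat semigroup on test functions. -/
def heat (t : ℝ) : LocallyConstant D.Z ℝ →ₗ[ℝ] LocallyConstant D.Z ℝ :=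
  S.diag fun i => Real.exp (S.ev i * t)

/-- The exponential formula, which carries contractivity from the resolvents to the heat operators.
On an eigenfunction it is the limit (1 + x/k)^k → exp x. -/
theorem tendsto_resolvent_pow (t : ℝ) (u : LocallyConstant D.Z ℝ) :
    Tendsto (fun k : ℕ => D.toC ((S.resolvent (t / k) ^ k) u)) atTop (𝓝 (D.toC (S.heat t u))) := by
  induction u using S.induction with
  | hψ i =>
    have h1 : ∀ k : ℕ, (S.resolvent (t / k) ^ k) (S.ψ i) =
        ((1 + -(S.ev i * t) / k) ^ k)⁻¹ • S.ψ i := by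
      intro k
      -- The exponent is separated from the step size t / k so that induction can run on it alone.
      have h2 : ∀ j : ℕ, (S.resolvent (t / k) ^ j) (S.ψ i) =
          ((1 + -(S.ev i * t) / k) ^ j)⁻¹ • S.ψ i := by
        intro j
        induction j with
        | zero => simp
        | succ j ih =>
          rw [pow_succ', Module.End.mul_apply, ih, map_smul, resolvent, diag_ψ, smul_smul,
            pow_succ, mul_inv]
          congr 3
          ring
      exact h2 k
    simp only [h1, heat, diag_ψ, map_smul]
    refine Tendsto.smul_const ?_ _
    have h3 := (Real.tendsto_one_add_div_pow_exp (-(S.ev i * t))).inv₀ (Real.exp_ne_zero _)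
    rwa [Real.exp_neg, inv_inv] at h3
  | hadd u v hu hv => simpa only [map_add] using hu.add hv
  | hsmul c u hu => simpa only [map_smul] using hu.const_smul c

theorem norm_heat_le {t : ℝ} (ht : 0 ≤ t) (u : LocallyConstant D.Z ℝ) :
    ‖D.toC (S.heat t u)‖ ≤ ‖D.toC u‖ := by
  refine le_of_tendsto (S.tendsto_resolvent_pow t u).norm (Eventually.of_forall fun k => ?_)
  have h : ∀ j : ℕ, ‖D.toC ((S.resolvent (t / k) ^ j) u)‖ ≤ ‖D.toC u‖ := by
    intro j
    induction j with
    | zero => simp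
    | succ j ih =>
      rw [pow_succ', Module.End.mul_apply]
      exact (S.norm_resolvent_le (by positivity) _).trans ih
  exact h k

theorem heat_add (s t : ℝ) (u : LocallyConstant D.Z ℝ) :
    S.heat (s + t) u = S.heat s (S.heat t u) := by
  rw [heat, heat, heat, diag_mul]
  congr 2
  funext i
  simp [mul_add, Real.exp_add]

theorem heat_zero (u : LocallyConstant D.Z ℝ) : S.heat 0 u = u := by
  rw [heat]
  simp only [mul_zero, Real.exp_zero]
  exact S.diag_one u

theorem heat_of_eigenvector (t : ℝ) {μ : ℝ} {u : LocallyConstant D.Z ℝ}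
    (hu : D.parisi ℝ α b u = μ • u) : S.heat t u = Real.exp (μ * t) • u :=
  S.diag_comp_apply_of_eigenvector (fun x => Real.exp (x * t)) hu

theorem heat_one (t : ℝ) : S.heat t 1 = 1 := by
  have h : D.parisi ℝ α b 1 = (0 : ℝ) • 1 := by
    ext x
    rw [zero_smul, parisi_apply]
    simp
  simpa using S.heat_of_eigenvector t h

theorem hasDerivAt_heat (u : LocallyConstant D.Z ℝ) (t : ℝ) :
    HasDerivAt (fun t => D.toC (S.heat t u)) (D.toC (S.heat t (D.parisi ℝ α b u))) t := by
  induction u using S.induction with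
  | hψ i =>
    simp only [S.parisi_ψ, heat, map_smul, diag_ψ]
    have h := ((hasDerivAt_id t).const_mul (S.ev i)).exp.smul_const (D.toC (S.ψ i))
    convert! h using 1
    rw [smul_smul]
    simp [mul_comm]
  | hadd u v hu hv => simpa only [map_add] using! hu.add hv
  | hsmul c u hu => simpa only [map_smul] using! hu.const_smul c

/-- The heat semigroup on continuous functions. -/
def heatSemigroup (t : ℝ≥0) : C(D.Z, ℝ) →L[ℝ] C(D.Z, ℝ) :=
  (D.toC ∘ₗ S.heat t).extendOfNorm D.toC

theorem heatSemigroup_toC (t : ℝ≥0) (u : LocallyConstant D.Z ℝ) :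
    S.heatSemigroup t (D.toC u) = D.toC (S.heat t u) :=
  LinearMap.extendOfNorm_eq D.denseRange_toC
    ⟨1, fun u => by simpa using S.norm_heat_le t.2 u⟩ u

theorem norm_heatSemigroup_le (t : ℝ≥0) (u : C(D.Z, ℝ)) : ‖S.heatSemigroup t u‖ ≤ ‖u‖ := by
  rw [← one_mul ‖u‖]
  exact LinearMap.norm_extendOfNorm_apply_le D.denseRange_toC 1
    (fun u => by simpa using S.norm_heat_le t.2 u) u

theorem heatSemigroup_one (t : ℝ≥0) : S.heatSemigroup t 1 = 1 := by
  have h := S.heatSemigroup_toC t 1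
  rw [S.heat_one] at h
  exact h

variable (D) in
theorem continuousLinearMap_ext {E : Type*} [NormedAddCommGroup E] [NormedSpace ℝ E]
    {f g : C(D.Z, ℝ) →L[ℝ] E} (h : ∀ u, f (D.toC u) = g (D.toC u)) : f = g :=
  ContinuousLinearMap.coeFn_injective
    (D.denseRange_toC.equalizer f.continuous g.continuous (funext h))

/-- A contraction of `C(X, ℝ)` which preserves the constants is positive. -/
theorem _root_.ContinuousLinearMap.nonneg_of_norm_le_of_map_one {X : Type*} [TopologicalSpace X]
    [CompactSpace X] {T : C(X, ℝ) →L[ℝ] C(X, ℝ)} (hT : ∀ u, ‖T u‖ ≤ ‖u‖) (h1 : T 1 = 1)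
    {u : C(X, ℝ)} (hu : 0 ≤ u) : 0 ≤ T u := by
  set M := ‖u‖
  -- Values in [0, M] are those within M/2 of the constant M/2; T preserves this bound, which forces
  -- T u ≥ 0.
  have hle : ‖u - (M / 2) • 1‖ ≤ M / 2 := by
    rw [ContinuousMap.norm_le _ (by positivity)]
    intro x
    have h2 : 0 ≤ u x := hu x
    have h3 : u x ≤ M := (le_abs_self _).trans (u.norm_coe_le_norm x)
    simp only [ContinuousMap.sub_apply, ContinuousMap.smul_apply, ContinuousMap.one_apply,
      smul_eq_mul, mul_one, Real.norm_eq_abs]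
    rw [abs_le]
    constructor <;> linarith
  have h := (hT _).trans hle
  rw [map_sub, map_smul, h1] at h
  intro x
  have hx := (ContinuousMap.norm_coe_le_norm _ x).trans h
  simp only [ContinuousMap.sub_apply, ContinuousMap.smul_apply, ContinuousMap.one_apply,
      smul_eq_mul, mul_one, Real.norm_eq_abs] at hx
  have := (abs_le.1 hx).1
  change 0 ≤ T u x
  linarith

theorem tendsto_heatSemigroup (u : C(D.Z, ℝ)) :
    Tendsto (fun t => S.heatSemigroup t u) (𝓝 0) (𝓝 u) := by
  rw [Metric.tendsto_nhds]
  intro ε hε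
  obtain ⟨v, hv⟩ := D.denseRange_toC.exists_dist_lt u (show 0 < ε / 3 by positivity)
  have h1 : Tendsto (fun t : ℝ≥0 => D.toC (S.heat t v)) (𝓝 0) (𝓝 (D.toC v)) := by
    have h := (S.hasDerivAt_heat v 0).continuousAt.tendsto
    rw [S.heat_zero] at h
    exact h.comp (NNReal.tendsto_coe.2 tendsto_id)
  filter_upwards [Metric.tendsto_nhds.1 h1 (ε / 3) (by positivity)] with t ht
  have h2 : dist (S.heatSemigroup t u) (D.toC (S.heat t v)) ≤ dist u (D.toC v) := by
    rw [← S.heatSemigroup_toC, dist_eq_norm, ← map_sub, dist_eq_norm]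
    exact S.norm_heatSemigroup_le t _
  calc _ ≤ dist (S.heatSemigroup t u) (D.toC (S.heat t v)) +
        dist (D.toC (S.heat t v)) (D.toC v) + dist (D.toC v) u := dist_triangle4 _ _ _ _
    _ < ε / 3 + ε / 3 + ε / 3 := by
      rw [dist_comm _ u]
      exact add_lt_add (add_lt_add (h2.trans_lt hv) ht) hv
    _ = ε := by ring

theorem isFellerSemigroup : IsFellerSemigroup S.heatSemigroup where
  zero := continuousLinearMap_ext D fun u => by
    rw [S.heatSemigroup_toC, NNReal.coe_zero, S.heat_zero]
    rfl
  add s t := continuousLinearMap_ext D fun u => by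
    rw [S.heatSemigroup_toC, NNReal.coe_add, S.heat_add, ContinuousLinearMap.comp_apply,
      S.heatSemigroup_toC, S.heatSemigroup_toC]
  tendsto_zero := S.tendsto_heatSemigroup
  nonneg t _ hu := ContinuousLinearMap.nonneg_of_norm_le_of_map_one (S.norm_heatSemigroup_le t)
    (S.heatSemigroup_one t) hu
  one := S.heatSemigroup_one

end EigenSystem

end PadicGraph

end

noncomputable section

/-! ### Closures of operators defined on a dense subspace -/

namespace LinearPMap

variable {𝕜 S E : Type*} [NontriviallyNormedField 𝕜] [AddCommGroup S] [Module 𝕜 S]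
  [NormedAddCommGroup E] [NormedSpace 𝕜 E] {ι : S →ₗ[𝕜] E} {hι : Function.Injective ι}
  {A : S →ₗ[𝕜] S}

theorem mem_graph_ofInjective {x y : E} :
    (x, y) ∈ (ofInjective ι hι A).graph ↔ ∃ s, ι s = x ∧ ι (A s) = y := by
  rw [mem_graph_iff]
  constructor
  · rintro ⟨z, rfl, rfl⟩
    refine ⟨(LinearEquiv.ofInjective ι hι).symm z, ?_, rfl⟩
    exact congrArg Subtype.val ((LinearEquiv.ofInjective ι hι).apply_symm_apply z)
  · rintro ⟨s, rfl, rfl⟩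
    refine ⟨LinearEquiv.ofInjective ι hι s, rfl, ?_⟩
    change ι (A ((LinearEquiv.ofInjective ι hι).symm (LinearEquiv.ofInjective ι hι s))) = _
    rw [LinearEquiv.symm_apply_apply]

theorem mem_closure_graph_ofInjective {x y : E} :
    (x, y) ∈ (ofInjective ι hι A).graph.topologicalClosure ↔
      ∃ s : ℕ → S, Tendsto (fun n => ι (s n)) atTop (𝓝 x) ∧
        Tendsto (fun n => ι (A (s n))) atTop (𝓝 y) := by
  rw [← SetLike.mem_coe, Submodule.topologicalClosure_coe, mem_closure_iff_seq_limit]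
  constructor
  · rintro ⟨z, hz, hlim⟩
    choose s hs using fun n => mem_graph_ofInjective.1 (hz n)
    refine ⟨s, ?_, ?_⟩
    · simpa only [hs, Function.comp_def] using (continuous_fst.tendsto _).comp hlim
    · simpa only [hs, Function.comp_def] using (continuous_snd.tendsto _).comp hlim
  · rintro ⟨s, h1, h2⟩
    exact ⟨fun n => (ι (s n), ι (A (s n))), fun n => mem_graph_ofInjective.2 ⟨s n, rfl, rfl⟩,
      h1.prodMk_nhds h2⟩

/-- The hypothesis is closability: only then is the closure of the graph again a graph. -/
theorem mem_graph_closure_ofInjective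
    (h : ∀ y, (0, y) ∈ (ofInjective ι hι A).graph.topologicalClosure → y = 0) {x y : E} :
    (x, y) ∈ (ofInjective ι hι A).closure.graph ↔
      ∃ s : ℕ → S, Tendsto (fun n => ι (s n)) atTop (𝓝 x) ∧
        Tendsto (fun n => ι (A (s n))) atTop (𝓝 y) := by
  have hcl : (ofInjective ι hι A).IsClosable := by
    refine ⟨_, (Submodule.toLinearPMap_graph_eq _ ?_).symm⟩
    rintro ⟨x, y⟩ hxy rfl
    exact h y hxy
  rw [← hcl.graph_closure_eq_closure_graph, mem_closure_graph_ofInjective]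

end LinearPMap

/-! ### Contraction semigroups -/

section Semigroup

variable {E : Type*} [NormedAddCommGroup E] [NormedSpace ℝ E] {T : ℝ≥0 → E →L[ℝ] E}

/-- Factoring out the operator at the smaller time bounds the distance between T r u and T s u by
that between T |r - s| u and u, so continuity at 0 spreads. -/
theorem continuous_of_contraction_semigroup (hadd : ∀ s t, T (s + t) = (T s).comp (T t))
    (hT : ∀ t u, ‖T t u‖ ≤ ‖u‖) {u : E} (hu : Tendsto (fun t => T t u) (𝓝 0) (𝓝 u)) :
    Continuous fun t => T t u := by
  have hle : ∀ r s : ℝ≥0, r ≤ s → dist (T r u) (T s u) ≤ dist (T (nndist r s) u) u := by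
    intro r s hrs
    have h : nndist r s = s - r := by
      rw [nndist_comm, NNReal.nndist_eq, tsub_eq_zero_of_le hrs, max_eq_left zero_le]
    rw [h, dist_comm]
    nth_rewrite 1 [← add_tsub_cancel_of_le hrs]
    rw [hadd, ContinuousLinearMap.comp_apply, dist_eq_norm, dist_eq_norm, ← map_sub]
    exact hT _ _
  have hle' : ∀ r s : ℝ≥0, dist (T r u) (T s u) ≤ dist (T (nndist r s) u) u := by
    intro r s
    rcases le_total r s with h | h
    · exact hle r s h
    · rw [dist_comm, nndist_comm]
      exact hle s r h
  rw [continuous_iff_continuousAt]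
  intro s
  refine tendsto_iff_dist_tendsto_zero.2 (squeeze_zero (fun _ => dist_nonneg)
    (fun r => hle' r s) ?_)
  have h1 : Tendsto (fun r => nndist r s) (𝓝 s) (𝓝 0) := by
    have : Continuous fun r => nndist r s := by fun_prop
    simpa using this.tendsto s
  exact tendsto_iff_dist_tendsto_zero.1 (hu.comp h1)

/-- By the semigroup law the right derivative of T s u is μ T s u at every s ≥ 0. Hence exp(-μs) T s
u is continuous with vanishing right derivative, so constant. -/
theorem eq_exp_smul_of_tendsto (hadd : ∀ s t, T (s + t) = (T s).comp (T t))
    (hzero : T 0 = ContinuousLinearMap.id ℝ E)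
    (hT : ∀ t u, ‖T t u‖ ≤ ‖u‖) {u : E} (hu : Tendsto (fun t => T t u) (𝓝 0) (𝓝 u)) {μ : ℝ}
    (hμ : Tendsto (fun t : ℝ≥0 => (t : ℝ)⁻¹ • (T t u - u)) (𝓝[>] 0) (𝓝 (μ • u))) (t : ℝ≥0) :
    T t u = Real.exp (μ * t) • u := by
  have hcont := continuous_of_contraction_semigroup hadd hT hu
  have hderiv : ∀ s : ℝ, 0 ≤ s →
      HasDerivWithinAt (fun s : ℝ => T s.toNNReal u) (μ • T s.toNNReal u) (Set.Ici s) s := by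
    intro s hs
    rw [← hasDerivWithinAt_Ioi_iff_Ici, hasDerivWithinAt_iff_tendsto_slope' (by simp)]
    have h1 : Tendsto (fun r : ℝ => (r - s).toNNReal) (𝓝[>] s) (𝓝[>] 0) := by
      refine tendsto_nhdsWithin_iff.2 ⟨?_, ?_⟩
      · have : Continuous fun r : ℝ => (r - s).toNNReal := by fun_prop
        have h := this.tendsto s
        rw [sub_self, Real.toNNReal_zero] at h
        exact h.mono_left nhdsWithin_le_nhds
      · filter_upwards [self_mem_nhdsWithin] with r hr
        simpa using! hr
    have h2 := ((T s.toNNReal).continuous.tendsto _).comp (hμ.comp h1)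
    rw [map_smul] at h2
    refine h2.congr' ?_
    filter_upwards [self_mem_nhdsWithin] with r hr
    have hsr : s < r := hr
    have h3 : r.toNNReal = s.toNNReal + (r - s).toNNReal := by
      rw [← Real.toNNReal_add hs (sub_nonneg.2 hsr.le), add_sub_cancel]
    simp only [Function.comp_apply, slope, vsub_eq_sub, map_smul, map_sub]
    rw [h3, hadd, Real.coe_toNNReal _ (sub_nonneg.2 hsr.le), ContinuousLinearMap.comp_apply]
  have hconst := constant_of_has_deriv_right_zero
    (f := fun s : ℝ => Real.exp (-(μ * s)) • T s.toNNReal u) (a := 0) (b := t)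
    (by
      refine Continuous.continuousOn (Continuous.smul (by fun_prop) ?_)
      exact hcont.comp continuous_real_toNNReal)
    (fun s hs => by
      have h1 : HasDerivWithinAt (fun s : ℝ => Real.exp (-(μ * s)))
          (Real.exp (-(μ * s)) * -μ) (Set.Ici s) s := by
        have := ((hasDerivAt_id s).const_mul μ).fun_neg.exp
        simpa using this.hasDerivWithinAt
      have h2 := h1.fun_smul (hderiv s hs.1)
      convert h2 using 1
      rw [smul_smul, mul_neg, neg_smul]
      simp)
    t ⟨t.2, le_rfl⟩
  simp only [Real.toNNReal_coe, mul_zero, neg_zero, Real.exp_zero, one_smul, Real.toNNReal_zero,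
    hzero, ContinuousLinearMap.id_apply] at hconst
  nth_rewrite 2 [← hconst]
  rw [smul_smul, ← Real.exp_add, add_neg_cancel, Real.exp_zero, one_smul]

end Semigroup

/-- Positivity applied to ‖u‖ - v with v = ±u, together with T 1 = 1. -/
theorem IsFellerSemigroup.norm_apply_le {X : Type*} [TopologicalSpace X] [CompactSpace X]
    {T : ℝ≥0 → C(X, ℝ) →L[ℝ] C(X, ℝ)} (hT : IsFellerSemigroup T) (t : ℝ≥0) (u : C(X, ℝ)) :
    ‖T t u‖ ≤ ‖u‖ := by
  have key : ∀ v : C(X, ℝ), (∀ x, v x ≤ ‖u‖) → ∀ x, T t v x ≤ ‖u‖ := by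
    intro v hv x
    have h := hT.nonneg t (‖u‖ • 1 - v) fun x => by simpa using hv x
    rw [map_sub, map_smul, hT.one] at h
    simpa using h x
  rw [ContinuousMap.norm_le _ (norm_nonneg u)]
  intro x
  rw [Real.norm_eq_abs, abs_le']
  refine ⟨key u (fun x => (le_abs_self _).trans (u.norm_coe_le_norm x)) x, ?_⟩
  have := key (-u) (fun x => (neg_le_abs _).trans (u.norm_coe_le_norm x)) x
  rwa [map_neg] at this

/-! ### The generator of the heat semigroup and uniqueness -/

namespace PadicGraph

variable {p : ℕ} [Fact p.Prime] {V : Type*} [Finite V] {D : PadicGraph p V}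
  {α : ℝ} {b : InteractionType} {ι : Type}

namespace EigenSystem

variable (S : D.EigenSystem α b ι)

/-- The mean value inequality for the heat orbit of u minus its linear part. -/
theorem norm_heat_sub_le {t ε : ℝ} (ht : 0 ≤ t) (u : LocallyConstant D.Z ℝ)
    (h : ∀ s, 0 ≤ s → s ≤ t →
      ‖D.toC (S.heat s (D.parisi ℝ α b u)) - D.toC (D.parisi ℝ α b u)‖ ≤ ε) :
    ‖D.toC (S.heat t u) - D.toC u - t • D.toC (D.parisi ℝ α b u)‖ ≤ ε * t := by
  have h1 := norm_image_sub_le_of_norm_deriv_le_segment' (a := 0) (b := t) (C := ε)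
    (f := fun s => D.toC (S.heat s u) - s • D.toC (D.parisi ℝ α b u))
    (f' := fun s => D.toC (S.heat s (D.parisi ℝ α b u)) - D.toC (D.parisi ℝ α b u))
    (fun s _ => by
      have h2 := (hasDerivAt_id s).smul_const (D.toC (D.parisi ℝ α b u))
      rw [one_smul] at h2
      exact ((S.hasDerivAt_heat u s).fun_sub h2).hasDerivWithinAt)
    (fun s hs => h s hs.1 hs.2.le) t ⟨ht, le_rfl⟩
  simp only [zero_smul, sub_zero, S.heat_zero] at h1
  rwa [sub_right_comm]

theorem norm_heatSemigroup_sub_le {s : ℕ → LocallyConstant D.Z ℝ} {u w : C(D.Z, ℝ)}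
    (hu : Tendsto (fun n => D.toC (s n)) atTop (𝓝 u))
    (hw : Tendsto (fun n => D.toC (D.parisi ℝ α b (s n))) atTop (𝓝 w)) {t : ℝ≥0} {ε : ℝ}
    (h : ∀ r ≤ t, ‖S.heatSemigroup r w - w‖ ≤ ε) :
    ‖S.heatSemigroup t u - u - (t : ℝ) • w‖ ≤ ε * t := by
  have hlim1 : Tendsto (fun n => ‖D.toC (S.heat t (s n)) - D.toC (s n) -
      (t : ℝ) • D.toC (D.parisi ℝ α b (s n))‖) atTop
      (𝓝 ‖S.heatSemigroup t u - u - (t : ℝ) • w‖) := by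
    have h1 := ((S.heatSemigroup t).continuous.tendsto u).comp hu
    simp only [Function.comp_def, S.heatSemigroup_toC] at h1
    exact ((h1.sub hu).sub (hw.const_smul _)).norm
  have hlim2 : Tendsto (fun n => (2 * ‖D.toC (D.parisi ℝ α b (s n)) - w‖ + ε) * (t : ℝ)) atTop
      (𝓝 (ε * t)) := by
    have h2 := ((((tendsto_iff_norm_sub_tendsto_zero.1 hw).const_mul 2).add_const ε).mul_const
      (t : ℝ))
    simpa using h2
  refine le_of_tendsto_of_tendsto' hlim1 hlim2 fun n => S.norm_heat_sub_le t.2 _ fun r hr hrt => ?_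
  lift r to ℝ≥0 using hr
  rw [← S.heatSemigroup_toC]
  set v := D.toC (D.parisi ℝ α b (s n))
  have h3 := S.norm_heatSemigroup_le r (v - w)
  have h4 := h r hrt
  calc ‖S.heatSemigroup r v - v‖
      = ‖S.heatSemigroup r (v - w) + (S.heatSemigroup r w - w) + (w - v)‖ := by
        rw [map_sub]
        congr 1
        abel
    _ ≤ ‖v - w‖ + ε + ‖v - w‖ := by
        refine (norm_add₃_le).trans ?_
        rw [norm_sub_rev w v]
        gcongr
    _ = _ := by ring

theorem tendsto_of_closure {s : ℕ → LocallyConstant D.Z ℝ} {u w : C(D.Z, ℝ)}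
    (hu : Tendsto (fun n => D.toC (s n)) atTop (𝓝 u))
    (hw : Tendsto (fun n => D.toC (D.parisi ℝ α b (s n))) atTop (𝓝 w)) :
    Tendsto (fun t : ℝ≥0 => (t : ℝ)⁻¹ • (S.heatSemigroup t u - u)) (𝓝[>] 0) (𝓝 w) := by
  rw [Metric.tendsto_nhds]
  intro ε hε
  obtain ⟨δ, hδ, h⟩ := Metric.eventually_nhds_iff.1
    (Metric.tendsto_nhds.1 (S.tendsto_heatSemigroup w) (ε / 2) (by positivity))
  filter_upwards [self_mem_nhdsWithin, mem_nhdsWithin_of_mem_nhds (Metric.ball_mem_nhds 0 hδ)]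
    with t ht htδ
  have ht0 : 0 < (t : ℝ) := ht
  have hle := S.norm_heatSemigroup_sub_le hu hw (t := t) (ε := ε / 2) fun r hr => by
    rw [← dist_eq_norm]
    refine (h (lt_of_le_of_lt ?_ htδ)).le
    simpa [NNReal.dist_eq] using hr
  have heq : (t : ℝ)⁻¹ • (S.heatSemigroup t u - u) - w =
      (t : ℝ)⁻¹ • (S.heatSemigroup t u - u - (t : ℝ) • w) := by
    rw [smul_sub (t : ℝ)⁻¹ _ ((t : ℝ) • w), smul_smul, inv_mul_cancel₀ ht0.ne', one_smul]
  rw [dist_eq_norm, heq, norm_smul, norm_inv, Real.norm_of_nonneg ht0.le, inv_mul_lt_iff₀ ht0]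
  nlinarith

/-- Closability comes from the semigroup: if test functions tend to 0 and their images to w, then w
is the limit of the difference quotients of the zero orbit. -/
theorem mem_graph_parisiC (S : D.EigenSystem α b ι) {u w : C(D.Z, ℝ)} : (u, w) ∈ (D.parisiC α b).graph ↔
    ∃ s : ℕ → LocallyConstant D.Z ℝ, Tendsto (fun n => D.toC (s n)) atTop (𝓝 u) ∧
      Tendsto (fun n => D.toC (D.parisi ℝ α b (s n))) atTop (𝓝 w) := by
  refine LinearPMap.mem_graph_closure_ofInjective fun w hw => ?_
  obtain ⟨s, h1, h2⟩ := LinearPMap.mem_closure_graph_ofInjective.1 hw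
  have h := S.tendsto_of_closure h1 h2
  simp only [map_zero, sub_zero, smul_zero] at h
  exact tendsto_nhds_unique h tendsto_const_nhds

/-- That the generator extends the closure is `tendsto_of_closure`. Conversely, for (u, w) in the
generator, the extended resolvent R at h = 1 gives R (u - w) in the domain of the closure, and it
remains to see that this is u. -/
theorem isGenerator : IsGenerator (D.parisiC α b) S.heatSemigroup := by
  intro u w
  rw [S.mem_graph_parisiC]
  refine ⟨fun ⟨s, h1, h2⟩ => S.tendsto_of_closure h1 h2, fun hw => ?_⟩
  let R : C(D.Z, ℝ) →L[ℝ] C(D.Z, ℝ) := (D.toC ∘ₗ S.resolvent 1).extendOfNorm D.toC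
  have hR : ∀ v, R (D.toC v) = D.toC (S.resolvent 1 v) := fun v =>
    LinearMap.extendOfNorm_eq D.denseRange_toC
      ⟨1, fun v => by simpa using S.norm_resolvent_le zero_le_one v⟩ v
  obtain ⟨f, hf, hlim⟩ := mem_closure_iff_seq_limit.1 (D.denseRange_toC (u - w))
  choose s hs using hf
  replace hlim : Tendsto (fun n => D.toC (s n)) atTop (𝓝 (u - w)) := by simpa only [hs] using hlim
  have h1 : Tendsto (fun n => D.toC (S.resolvent 1 (s n))) atTop (𝓝 (R (u - w))) := by
    simpa only [Function.comp_def, hR] using (R.continuous.tendsto _).comp hlim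
  have h2 : Tendsto (fun n => D.toC (D.parisi ℝ α b (S.resolvent 1 (s n)))) atTop
      (𝓝 (R (u - w) - (u - w))) := by
    refine (h1.sub hlim).congr fun n => ?_
    have := S.resolvent_sub zero_le_one (s n)
    rw [one_smul, sub_eq_iff_eq_add] at this
    rw [← map_sub]
    congr 1
    nth_rewrite 1 [this]
    abel
  suffices hg : u - R (u - w) = 0 by
    rw [← sub_eq_zero.1 hg] at h1 h2
    rw [sub_sub_cancel] at h2
    exact ⟨_, h1, h2⟩
  -- The generator maps g to itself, so the semigroup at time 1 multiplies g by exp 1 > 1;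
  -- contractivity forces g = 0.
  set g := u - R (u - w)
  have hlim' : Tendsto (fun t : ℝ≥0 => (t : ℝ)⁻¹ • (S.heatSemigroup t g - g)) (𝓝[>] 0)
      (𝓝 ((1 : ℝ) • g)) := by
    have h3 := hw.sub (S.tendsto_of_closure h1 h2)
    have h4 : w - (R (u - w) - (u - w)) = (1 : ℝ) • g := by
      rw [one_smul]
      simp only [g]
      abel
    rw [h4] at h3
    refine h3.congr fun t => ?_
    rw [← smul_sub]
    congr 1
    simp only [g, map_sub]
    abel
  have hS := S.isFellerSemigroup
  have h5 := eq_exp_smul_of_tendsto hS.add hS.zero hS.norm_apply_le (hS.tendsto_zero g) hlim' 1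
  have h6 := hS.norm_apply_le 1 g
  rw [h5, norm_smul, Real.norm_of_nonneg (Real.exp_pos _).le] at h6
  have h7 : 1 < Real.exp (1 * (1 : ℝ≥0)) := by simp
  by_contra hne
  have := norm_pos_iff.2 hne
  nlinarith

theorem eq_heat_of_isGenerator {T : ℝ≥0 → C(D.Z, ℝ) →L[ℝ] C(D.Z, ℝ)} (hT : IsFellerSemigroup T)
    (hgen : IsGenerator (D.parisiC α b) T) (t : ℝ≥0) (u : LocallyConstant D.Z ℝ) :
    T t (D.toC u) = D.toC (S.heat t u) := by
  have h : (T t).toLinearMap ∘ₗ D.toC = D.toC ∘ₗ S.heat t := S.linearMap_ext fun i => by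
    have h1 : (D.toC (S.ψ i), S.ev i • D.toC (S.ψ i)) ∈ (D.parisiC α b).graph :=
      S.mem_graph_parisiC.2 ⟨fun _ => S.ψ i, tendsto_const_nhds, by
        rw [← map_smul, ← S.parisi_ψ]
        exact tendsto_const_nhds⟩
    have h2 := eq_exp_smul_of_tendsto hT.add hT.zero hT.norm_apply_le (hT.tendsto_zero _)
      ((hgen _ _).1 h1) t
    rw [LinearMap.comp_apply, LinearMap.comp_apply, heat, diag_ψ, map_smul]
    exact h2
  exact LinearMap.congr_fun h u

end EigenSystem

end PadicGraph

end

noncomputable section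

/-! ### Hilbert bases and eigenbases -/

section HilbertBasis

variable {𝕜 E ι : Type*} [RCLike 𝕜] [NormedAddCommGroup E] [InnerProductSpace 𝕜 E]

theorem HilbertBasis.ext_inner (e : HilbertBasis ι 𝕜 E) {x y : E}
    (h : ∀ i, inner 𝕜 (e i) x = inner 𝕜 (e i) y) : x = y :=
  e.repr.injective (lp.ext (funext fun i => by simpa [e.repr_apply_apply] using h i))

theorem HilbertBasis.norm_le_mul_norm (e : HilbertBasis ι 𝕜 E) {x y : E} {C : ℝ} (hC : 0 ≤ C)
    (h : ∀ i, ‖inner 𝕜 (e i) x‖ ≤ C * ‖inner 𝕜 (e i) y‖) : ‖x‖ ≤ C * ‖y‖ := by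
  have hp : 0 < (2 : ENNReal).toReal := by norm_num
  have hx := lp.hasSum_norm hp (e.repr x)
  have hy := (lp.hasSum_norm hp (e.repr y)).mul_left (C ^ (2 : ENNReal).toReal)
  simp only [e.repr_apply_apply, LinearIsometryEquiv.norm_map] at hx hy
  rw [← Real.rpow_le_rpow_iff (norm_nonneg x) (by positivity) hp,
    Real.mul_rpow hC (norm_nonneg y)]
  refine hasSum_le (fun i => ?_) hx hy
  rw [← Real.mul_rpow hC (norm_nonneg _)]
  exact Real.rpow_le_rpow (norm_nonneg _) (h i) hp.le

theorem HilbertBasis.eq_sum_of_inner_eq_zero (e : HilbertBasis ι 𝕜 E) {x : E} (s : Finset ι)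
    (h : ∀ i ∉ s, inner 𝕜 (e i) x = 0) : x = ∑ i ∈ s, inner 𝕜 (e i) x • e i := by
  have h1 := e.hasSum_repr x
  simp only [e.repr_apply_apply] at h1
  exact h1.unique (hasSum_sum_of_ne_finset_zero fun i hi => by rw [h i hi, zero_smul])

end HilbertBasis

namespace PadicGraph

variable {p : ℕ} [Fact p.Prime] {V : Type*} (D : PadicGraph p V)

/-! ### Complex test functions -/

@[simp]
theorem complexify_apply (u : LocallyConstant D.Z ℝ) (x : D.Z) : D.complexify u x = u x := rfl

theorem complexify_add (u v : LocallyConstant D.Z ℝ) :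
    D.complexify (u + v) = D.complexify u + D.complexify v := by
  ext x
  simp

theorem complexify_smul (c : ℝ) (u : LocallyConstant D.Z ℝ) :
    D.complexify (c • u) = (c : ℂ) • D.complexify u := by
  ext x
  simp

theorem complexify_re_add_im (u : LocallyConstant D.Z ℂ) :
    u = D.complexify (u.map Complex.re) + Complex.I • D.complexify (u.map Complex.im) := by
  ext x
  simp [mul_comm Complex.I]

variable [Finite V]

theorem parisi_complexify (α : ℝ) (b : InteractionType) (u : LocallyConstant D.Z ℝ) :
    D.parisi ℂ α b (D.complexify u) = D.complexify (D.parisi ℝ α b u) := by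
  ext x
  rw [complexify_apply, parisi_apply, parisi_apply, ← integral_complex_ofReal]
  simp

theorem inner_toL2 (u v : LocallyConstant D.Z ℂ) :
    inner ℂ (D.toL2 u) (D.toL2 v) = ∫ x, conj (u x) * v x ∂D.haar := by
  have h := ContinuousMap.inner_toLp (𝕜 := ℂ) D.haar (u : C(D.Z, ℂ)) (v : C(D.Z, ℂ))
  simp only [mul_comm (conj _)]
  exact h

theorem inner_toL2_complexify (u v : LocallyConstant D.Z ℝ) :
    inner ℂ (D.toL2 (D.complexify u)) (D.toL2 (D.complexify v)) =
      ((∫ x, u x * v x ∂D.haar : ℝ) : ℂ) := by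
  rw [inner_toL2, ← integral_complex_ofReal]
  simp

/-- Complex Stone–Weierstrass gives sup-norm density in the continuous functions, which are dense in
L². -/
theorem denseRange_toL2 : DenseRange D.toL2 := by
  have h : DenseRange (LocallyConstant.toContinuousMap : LocallyConstant D.Z ℂ → C(D.Z, ℂ)) := by
    let A : StarSubalgebra ℂ C(D.Z, ℂ) :=
      { (LocallyConstant.toContinuousMapAlgHom ℂ : _ →ₐ[ℂ] C(D.Z, ℂ)).range with
        star_mem' := by
          rintro _ ⟨u, rfl⟩
          exact ⟨u.map star, rfl⟩ }
    have hA := ContinuousMap.starSubalgebra_topologicalClosure_eq_top_of_separatesPoints A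
      (LocallyConstant.separatesPoints_range_toContinuousMapAlgHom (X := D.Z) (Y := ℂ) ℂ)
    rw [DenseRange, dense_iff_closure_eq]
    exact congrArg (fun A : StarSubalgebra ℂ C(D.Z, ℂ) => (A : Set C(D.Z, ℂ))) hA
  exact (ContinuousMap.toLp_denseRange ℂ D.haar ℂ ENNReal.ofNat_ne_top).comp h
    (ContinuousMap.toLp 2 D.haar ℂ).continuous

variable {D} {α : ℝ} {b : InteractionType} {ι : Type}

namespace EigenSystem

variable (S : D.EigenSystem α b ι)

theorem orthonormal : Orthonormal ℂ fun i => D.toL2 (D.complexify (S.ψ i)) := by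
  classical
  rw [orthonormal_iff_ite]
  intro i j
  rw [inner_toL2_complexify]
  split_ifs with h
  · subst h
    rw [S.integral_self, Complex.ofReal_one]
  · rw [S.integral_ne i j h, Complex.ofReal_zero]

theorem span_complexify : Submodule.span ℂ (Set.range fun i => D.complexify (S.ψ i)) = ⊤ := by
  set P := Submodule.span ℂ (Set.range fun i => D.complexify (S.ψ i))
  have h : ∀ u, D.complexify u ∈ P := by
    intro u
    induction u using S.induction with
    | hψ i => exact Submodule.subset_span ⟨i, rfl⟩
    | hadd u v hu hv =>
      rw [complexify_add]
      exact P.add_mem hu hv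
    | hsmul c u hu =>
      rw [complexify_smul]
      exact P.smul_mem _ hu
  rw [eq_top_iff]
  intro u _
  rw [D.complexify_re_add_im u]
  exact P.add_mem (h _) (P.smul_mem _ (h _))

/-- The eigenfunctions as an algebraic basis of the complex test functions. -/
def complexBasis : Module.Basis ι ℂ (LocallyConstant D.Z ℂ) :=
  Module.Basis.mk (v := fun i => D.complexify (S.ψ i))
    (LinearIndependent.of_comp D.toL2 S.orthonormal.linearIndependent) S.span_complexify.ge

@[simp]
theorem complexBasis_apply (i : ι) : S.complexBasis i = D.complexify (S.ψ i) :=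
  Module.Basis.mk_apply _ _ i

theorem complex_linearMap_ext {M : Type*} [AddCommGroup M] [Module ℂ M]
    {f g : LocallyConstant D.Z ℂ →ₗ[ℂ] M}
    (h : ∀ i, f (D.complexify (S.ψ i)) = g (D.complexify (S.ψ i))) : f = g :=
  S.complexBasis.ext fun i => by simpa using h i

/-- The orthonormal basis of `L²` given by the eigenfunctions. -/
def hilbertBasis : HilbertBasis ι ℂ D.L2 :=
  HilbertBasis.mk S.orthonormal (by
    have h : Submodule.span ℂ (Set.range fun i => D.toL2 (D.complexify (S.ψ i))) =
        LinearMap.range D.toL2 := by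
      rw [LinearMap.range_eq_map, ← S.span_complexify, Submodule.map_span, ← Set.range_comp]
      rfl
    rw [h, top_le_iff, ← Submodule.dense_iff_topologicalClosure_eq_top]
    exact D.denseRange_toL2)

@[simp]
theorem hilbertBasis_apply (i : ι) : S.hilbertBasis i = D.toL2 (D.complexify (S.ψ i)) :=
  congrFun (HilbertBasis.coe_mk _ _) i

theorem parisi_complexify_ψ (i : ι) :
    D.parisi ℂ α b (D.complexify (S.ψ i)) = (S.ev i : ℂ) • D.complexify (S.ψ i) := by
  rw [parisi_complexify, S.parisi_ψ, complexify_smul]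

/-- The operator on complex test functions acting diagonally on the eigenfunctions. -/
def complexDiag (f : ι → ℂ) : LocallyConstant D.Z ℂ →ₗ[ℂ] LocallyConstant D.Z ℂ :=
  S.complexBasis.constr ℂ fun i => f i • D.complexify (S.ψ i)

@[simp]
theorem complexDiag_ψ (f : ι → ℂ) (i : ι) :
    S.complexDiag f (D.complexify (S.ψ i)) = f i • D.complexify (S.ψ i) := by
  rw [complexDiag, ← S.complexBasis_apply, S.complexBasis.constr_basis, S.complexBasis_apply]

theorem parisi_eq_complexDiag : D.parisi ℂ α b = S.complexDiag fun i => (S.ev i : ℂ) :=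
  S.complex_linearMap_ext fun i => by rw [S.parisi_complexify_ψ, complexDiag_ψ]

theorem inner_complexDiag (f : ι → ℂ) (i : ι) (u : LocallyConstant D.Z ℂ) :
    inner ℂ (S.hilbertBasis i) (D.toL2 (S.complexDiag f u)) =
      f i * inner ℂ (S.hilbertBasis i) (D.toL2 u) := by
  classical
  have h : (innerSL ℂ (S.hilbertBasis i)).toLinearMap ∘ₗ D.toL2 ∘ₗ S.complexDiag f =
      f i • (innerSL ℂ (S.hilbertBasis i)).toLinearMap ∘ₗ D.toL2 :=
    S.complex_linearMap_ext fun j => by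
      have hij := orthonormal_iff_ite.1 S.hilbertBasis.orthonormal i j
      simp only [LinearMap.comp_apply, complexDiag_ψ, map_smul, LinearMap.smul_apply,
        smul_eq_mul, ← S.hilbertBasis_apply, ContinuousLinearMap.coe_coe, innerSL_apply_apply, hij]
      split_ifs with h
      · rw [h]
      · simp
  exact LinearMap.congr_fun h u

theorem inner_parisi (i : ι) (u : LocallyConstant D.Z ℂ) :
    inner ℂ (S.hilbertBasis i) (D.toL2 (D.parisi ℂ α b u)) =
      S.ev i * inner ℂ (S.hilbertBasis i) (D.toL2 u) := by
  rw [S.parisi_eq_complexDiag, inner_complexDiag]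

/-- Fourier coefficients are continuous, so the diagonal action survives limits. This yields
closability and describes the closure. -/
theorem inner_eq_of_tendsto {s : ℕ → LocallyConstant D.Z ℂ} {g h : D.L2}
    (hg : Tendsto (fun n => D.toL2 (s n)) atTop (𝓝 g))
    (hh : Tendsto (fun n => D.toL2 (D.parisi ℂ α b (s n))) atTop (𝓝 h)) (i : ι) :
    inner ℂ (S.hilbertBasis i) h = S.ev i * inner ℂ (S.hilbertBasis i) g := by
  have h1 : Tendsto (fun n => inner ℂ (S.hilbertBasis i) (D.toL2 (D.parisi ℂ α b (s n)))) atTop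
      (𝓝 (inner ℂ (S.hilbertBasis i) h)) := tendsto_const_nhds.inner hh
  simp only [S.inner_parisi] at h1
  exact tendsto_nhds_unique h1 ((tendsto_const_nhds.inner hg).const_mul _)

theorem mem_graph_parisiL2 (S : D.EigenSystem α b ι) {g h : D.L2} :
    (g, h) ∈ (D.parisiL2 α b).graph ↔
      ∃ s : ℕ → LocallyConstant D.Z ℂ, Tendsto (fun n => D.toL2 (s n)) atTop (𝓝 g) ∧
        Tendsto (fun n => D.toL2 (D.parisi ℂ α b (s n))) atTop (𝓝 h) := by
  refine LinearPMap.mem_graph_closure_ofInjective fun h hh => ?_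
  obtain ⟨s, h1, h2⟩ := LinearPMap.mem_closure_graph_ofInjective.1 hh
  refine S.hilbertBasis.ext_inner fun i => ?_
  rw [S.inner_eq_of_tendsto h1 h2, inner_zero_right, mul_zero]

theorem inner_eq_of_mem_graph {g h : D.L2} (hgh : (g, h) ∈ (D.parisiL2 α b).graph) (i : ι) :
    inner ℂ (S.hilbertBasis i) h = S.ev i * inner ℂ (S.hilbertBasis i) g := by
  obtain ⟨s, h1, h2⟩ := S.mem_graph_parisiL2.1 hgh
  exact S.inner_eq_of_tendsto h1 h2 i

theorem _root_.isEigenbasis_iff {E ι : Type*} [NormedAddCommGroup E] [InnerProductSpace ℂ E]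
    {A : E →ₗ.[ℂ] E} {e : HilbertBasis ι ℂ E} {ev : ι → ℝ} :
    IsEigenbasis A e ev ↔ ∀ i, (e i, (ev i : ℂ) • e i) ∈ A.graph := by
  refine forall_congr' fun i => ?_
  rw [LinearPMap.mem_graph_iff]
  constructor
  · rintro ⟨h, h'⟩
    exact ⟨⟨e i, h⟩, rfl, h'⟩
  · rintro ⟨⟨y, hy⟩, rfl, h'⟩
    exact ⟨hy, h'⟩

theorem isEigenbasis : IsEigenbasis (D.parisiL2 α b) S.hilbertBasis S.ev := by
  rw [isEigenbasis_iff]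
  intro i
  refine S.mem_graph_parisiL2.2 ⟨fun _ => D.complexify (S.ψ i), ?_, ?_⟩
  · rw [hilbertBasis_apply]
    exact tendsto_const_nhds
  · simp only [S.parisi_complexify_ψ, map_smul, hilbertBasis_apply]
    exact tendsto_const_nhds

/-! ### The spectrum -/

/-- All but finitely many eigenvalues lie below Re z - 1, hence at distance at least 1 from z. If z
is an eigenvalue, its own term is 0 by the convention for inverses. -/
theorem exists_norm_inv_le (z : ℂ) : ∃ C, 0 ≤ C ∧ ∀ i, ‖(z - S.ev i)⁻¹‖ ≤ C := by
  have hfin := S.finite_ge (z.re - 1)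
  obtain ⟨C, hC⟩ := (hfin.image fun i => ‖(z - S.ev i)⁻¹‖).bddAbove
  refine ⟨max C 1, le_max_of_le_right zero_le_one, fun i => ?_⟩
  by_cases hi : z.re - 1 ≤ S.ev i
  · exact (hC ⟨i, hi, rfl⟩).trans (le_max_left _ _)
  · refine le_trans ?_ (le_max_right _ _)
    rw [norm_inv]
    refine inv_le_one_of_one_le₀ ?_
    refine le_trans ?_ (Complex.re_le_norm _)
    rw [Complex.sub_re, Complex.ofReal_re]
    linarith [not_le.1 hi]

/-- The inverse is diagonal with entries 1/(z - λ), bounded by Parseval. Approximation by test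
functions shows that its range lies in the domain of the closure. -/
theorem isResolventPoint {z : ℂ} (hz : ∀ i, z ≠ S.ev i) :
    (D.parisiL2 α b).IsResolventPoint z := by
  obtain ⟨C, hC, hle⟩ := S.exists_norm_inv_le z
  set f : ι → ℂ := fun i => (z - S.ev i)⁻¹ with hf
  have hne : ∀ i, z - S.ev i ≠ 0 := fun i => sub_ne_zero.2 (hz i)
  let R : D.L2 →L[ℂ] D.L2 := (D.toL2 ∘ₗ S.complexDiag f).extendOfNorm D.toL2
  have hR : ∀ u, R (D.toL2 u) = D.toL2 (S.complexDiag f u) := fun u =>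
    LinearMap.extendOfNorm_eq D.denseRange_toL2 ⟨C, fun u =>
      S.hilbertBasis.norm_le_mul_norm hC fun i => by
        rw [LinearMap.comp_apply, inner_complexDiag, norm_mul]
        exact mul_le_mul_of_nonneg_right (hle i) (norm_nonneg _)⟩ u
  have hinner : ∀ i g, inner ℂ (S.hilbertBasis i) (R g) = f i * inner ℂ (S.hilbertBasis i) g := by
    intro i g
    refine D.denseRange_toL2.induction_on g (isClosed_eq (by fun_prop) (by fun_prop)) fun u => ?_
    rw [hR, inner_complexDiag]
  have hgraph : ∀ g, (R g, z • R g - g) ∈ (D.parisiL2 α b).graph := by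
    intro g
    obtain ⟨v, hv, hlim⟩ := mem_closure_iff_seq_limit.1 (D.denseRange_toL2 g)
    choose s hs using hv
    obtain rfl : (fun n => D.toL2 (s n)) = v := funext hs
    have h1 : Tendsto (fun n => D.toL2 (S.complexDiag f (s n))) atTop (𝓝 (R g)) := by
      simpa only [Function.comp_def, hR] using (R.continuous.tendsto g).comp hlim
    refine S.mem_graph_parisiL2.2 ⟨fun n => S.complexDiag f (s n), h1, ?_⟩
    refine ((h1.const_smul z).sub hlim).congr fun n => ?_
    refine S.hilbertBasis.ext_inner fun i => ?_
    rw [inner_sub_right, inner_smul_right, S.inner_parisi, inner_complexDiag, hf]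
    field_simp [hne i]
    ring
  refine ⟨R, fun g => ?_, fun g => ?_⟩
  · obtain ⟨y, hy, hy'⟩ := LinearPMap.mem_graph_iff _ |>.1 (hgraph g)
    have hmem : R g ∈ (D.parisiL2 α b).domain := by
      have h2 := y.2
      rwa [hy] at h2
    refine ⟨hmem, ?_⟩
    obtain rfl : y = ⟨R g, hmem⟩ := Subtype.ext hy
    rw [hy', sub_sub_cancel]
  · refine S.hilbertBasis.ext_inner fun i => ?_
    rw [hinner, inner_sub_right, inner_smul_right,
      S.inner_eq_of_mem_graph (LinearPMap.mem_graph _ g), ← sub_mul, hf,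
      inv_mul_cancel_left₀ (hne i)]

theorem _root_.IsEigenbasis.mem_spec {E ι : Type*} [NormedAddCommGroup E] [InnerProductSpace ℂ E]
    {A : E →ₗ.[ℂ] E} {e : HilbertBasis ι ℂ E} {ev : ι → ℝ} (h : IsEigenbasis A e ev) (i : ι) :
    (ev i : ℂ) ∈ A.spec := by
  rintro ⟨R, -, hR⟩
  obtain ⟨hmem, hA⟩ := h i
  have h1 := hR ⟨e i, hmem⟩
  rw [hA, sub_self, map_zero] at h1
  exact e.orthonormal.ne_zero i h1.symm

theorem spec_eq : (D.parisiL2 α b).spec = Set.range fun i => (S.ev i : ℂ) := by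
  refine Set.Subset.antisymm (fun z hz => ?_) ?_
  · by_contra h
    exact hz (S.isResolventPoint fun i hi => h ⟨i, hi.symm⟩)
  · rintro _ ⟨i, rfl⟩
    exact S.isEigenbasis.mem_spec i

/-! ### Arbitrary eigenbases -/

section Eigenbasis

variable {κ : Type*} {e : HilbertBasis κ ℂ D.L2} {ev : κ → ℝ}

theorem inner_eq_zero_of_ne (he : IsEigenbasis (D.parisiL2 α b) e ev) {i : κ} {j : ι}
    (h : S.ev j ≠ ev i) : inner ℂ (S.hilbertBasis j) (e i) = 0 := by
  have h1 := S.inner_eq_of_mem_graph (isEigenbasis_iff.1 he i) j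
  rw [inner_smul_right] at h1
  rcases mul_eq_mul_right_iff.1 h1 with h2 | h2
  · exact absurd (by exact_mod_cast h2.symm) h
  · exact h2

theorem finite_eq (c : ℝ) : {j | S.ev j = c}.Finite :=
  (S.finite_ge c).subset fun _ hj => hj.ge

/-- The locally constant representative of an eigenfunction. -/
def representative (e : HilbertBasis κ ℂ D.L2) (ev : κ → ℝ) (i : κ) : LocallyConstant D.Z ℂ :=
  ∑ j ∈ (S.finite_eq (ev i)).toFinset,
    inner ℂ (S.hilbertBasis j) (e i) • D.complexify (S.ψ j)

theorem toL2_representative (he : IsEigenbasis (D.parisiL2 α b) e ev) (i : κ) :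
    D.toL2 (S.representative e ev i) = e i := by
  rw [S.hilbertBasis.eq_sum_of_inner_eq_zero (S.finite_eq (ev i)).toFinset
    fun j hj => S.inner_eq_zero_of_ne he (by simpa using hj)]
  simp [representative]

/-- An eigenvector whose eigenvalue were missing from the other system would be orthogonal to a
complete family. -/
theorem range_eq (he : IsEigenbasis (D.parisiL2 α b) e ev) : Set.range ev = Set.range S.ev := by
  refine Set.Subset.antisymm ?_ ?_
  · rintro _ ⟨i, rfl⟩
    by_contra h
    refine e.orthonormal.ne_zero i (S.hilbertBasis.ext_inner fun j => ?_)
    rw [inner_zero_right]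
    exact S.inner_eq_zero_of_ne he fun hj => h ⟨j, hj⟩
  · rintro _ ⟨j, rfl⟩
    by_contra h
    refine S.hilbertBasis.orthonormal.ne_zero j (e.ext_inner fun i => ?_)
    rw [inner_zero_right, ← inner_conj_symm,
      S.inner_eq_zero_of_ne he fun hj => h ⟨i, hj.symm⟩, map_zero]

/-- The basis vectors with eigenvalue c are independent and lie in the span of the finitely many
`S.ψ j` with that eigenvalue. -/
theorem finite_eigenbasis_eq (S : D.EigenSystem α b ι) (he : IsEigenbasis (D.parisiL2 α b) e ev) (c : ℝ) :
    {i | ev i = c}.Finite := by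
  set s := (S.finite_eq c).toFinset
  let W : Submodule ℂ D.L2 := Submodule.span ℂ (S.hilbertBasis '' {j | S.ev j = c})
  have : FiniteDimensional ℂ W := FiniteDimensional.span_of_finite ℂ ((S.finite_eq c).image _)
  have hmem : ∀ i : {i | ev i = c}, e i ∈ W := by
    rintro ⟨i, hi⟩
    rw [S.hilbertBasis.eq_sum_of_inner_eq_zero s
      fun j hj => S.inner_eq_zero_of_ne he (by simpa [s, show ev i = c from hi] using hj)]
    refine W.sum_mem fun j hj => W.smul_mem _ (Submodule.subset_span ?_)
    exact Set.mem_image_of_mem _ (by simpa [s] using hj)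
  have hli : LinearIndependent ℂ fun i : {i | ev i = c} => (⟨e i, hmem i⟩ : W) :=
    LinearIndependent.of_comp W.subtype
      (e.orthonormal.linearIndependent.comp _ Subtype.val_injective)
  have := hli.finite
  exact Set.toFinite _

end Eigenbasis

/-! ### The heat kernel -/

/-- The heat kernel, as a distribution. -/
def heatKernel (t : ℝ≥0) (x : D.Z) : D.Distribution :=
  S.complexBasis.constr ℂ fun i => ((Real.exp (S.ev i * t) * S.ψ i x : ℝ) : ℂ)

theorem heatKernel_ψ (t : ℝ≥0) (x : D.Z) (i : ι) :
    S.heatKernel t x (D.complexify (S.ψ i)) = ((Real.exp (S.ev i * t) * S.ψ i x : ℝ) : ℂ) := by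
  rw [heatKernel, ← S.complexBasis_apply, S.complexBasis.constr_basis]

theorem heatKernel_complexify (t : ℝ≥0) (x : D.Z) (u : LocallyConstant D.Z ℝ) :
    S.heatKernel t x (D.complexify u) = ((S.heat t u x : ℝ) : ℂ) := by
  induction u using S.induction with
  | hψ i => simp [heatKernel_ψ, heat]
  | hadd u v hu hv => rw [complexify_add, map_add, hu, hv]; simp
  | hsmul c u hu => rw [complexify_smul, map_smul, hu]; simp

theorem isHeatKernel : D.IsHeatKernel α b S.heatKernel := by
  refine ⟨S.heatSemigroup, S.isFellerSemigroup, S.isGenerator, fun t x u => ?_⟩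
  rw [S.heatKernel_complexify, S.heatSemigroup_toC]
  rfl

theorem eq_heatKernel {K : ℝ≥0 → D.Z → D.Distribution} (hK : D.IsHeatKernel α b K) :
    K = S.heatKernel := by
  obtain ⟨T, hT, hgen, h⟩ := hK
  funext t x
  refine S.complex_linearMap_ext fun i => ?_
  rw [h, S.eq_heat_of_isGenerator hT hgen, S.heatKernel_complexify]
  rfl

theorem complex_induction {P : LocallyConstant D.Z ℂ → Prop}
    (hψ : ∀ i, P (D.complexify (S.ψ i))) (hadd : ∀ u v, P u → P v → P (u + v))
    (hsmul : ∀ (c : ℂ) u, P u → P (c • u)) (u : LocallyConstant D.Z ℂ) : P u := by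
  have h : ∀ u, P (D.complexify u) := by
    intro u
    induction u using S.induction with
    | hψ i => exact hψ i
    | hadd u v hu hv =>
      rw [complexify_add]
      exact hadd _ _ hu hv
    | hsmul c u hu =>
      rw [complexify_smul]
      exact hsmul _ _ hu
  rw [D.complexify_re_add_im u]
  exact hadd _ _ (h _) (hsmul _ _ (h _))

/-- An eigenfunction expansion holds for all test functions if it does for the eigenfunctions. -/
theorem hasSum_of_ψ {κ : Type*} {K : D.Distribution} (a : κ → ℂ) (e : κ → D.L2)
    (h : ∀ k, HasSum (fun i => a i * inner ℂ (e i) (D.toL2 (D.complexify (S.ψ k))))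
      (K (D.complexify (S.ψ k)))) (u : LocallyConstant D.Z ℂ) :
    HasSum (fun i => a i * inner ℂ (e i) (D.toL2 u)) (K u) := by
  induction u using S.complex_induction with
  | hψ k => exact h k
  | hadd u v hu hv => simpa only [map_add, inner_add_right, mul_add] using hu.add hv
  | hsmul c u hu =>
    simp only [map_smul, inner_smul_right, smul_eq_mul]
    convert! hu.mul_left c using 2
    ring

/-- It suffices to test against one eigenfunction, which is orthogonal to every e i with a different
eigenvalue; only finitely many terms remain, all with the same exponential factor. -/
theorem hasSum_heatKernel_eigenbasis {κ : Type*} {e : HilbertBasis κ ℂ D.L2} {ev : κ → ℝ}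
    (he : IsEigenbasis (D.parisiL2 α b) e ev) {φ : κ → LocallyConstant D.Z ℂ}
    (hφ : ∀ i, D.toL2 (φ i) = e i) (t : ℝ≥0) (x : D.Z) (u : LocallyConstant D.Z ℂ) :
    HasSum (fun i => (Real.exp (ev i * t) : ℂ) * φ i x * ∫ y, conj (φ i y) * u y ∂D.haar)
      (S.heatKernel t x u) := by
  simp only [← D.inner_toL2, hφ]
  refine S.hasSum_of_ψ _ _ (fun k => ?_) u
  set s := (S.finite_eigenbasis_eq he (S.ev k)).toFinset
  have hzero : ∀ i ∉ s, inner ℂ (e i) (S.hilbertBasis k) = 0 := by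
    intro i hi
    rw [← inner_conj_symm, S.inner_eq_zero_of_ne he fun hk => hi (by simp [s, hk]), map_zero]
  -- The expansion is lifted from L² to test functions by injectivity of `toL2`, so that it can be
  -- evaluated at the point x.
  have hψ : D.complexify (S.ψ k) = ∑ i ∈ s, inner ℂ (e i) (S.hilbertBasis k) • φ i := by
    apply D.toL2_injective
    rw [← S.hilbertBasis_apply, map_sum]
    simp only [map_smul, hφ]
    exact e.eq_sum_of_inner_eq_zero s hzero
  have hsum : S.heatKernel t x (D.complexify (S.ψ k)) = ∑ i ∈ s, (Real.exp (ev i * t) : ℂ) *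
      φ i x * inner ℂ (e i) (D.toL2 (D.complexify (S.ψ k))) := by
    have hx := congrArg (LocallyConstant.evalₗ ℂ x) hψ
    simp only [map_sum, map_smul, LocallyConstant.evalₗ_apply, complexify_apply, smul_eq_mul] at hx
    rw [S.heatKernel_ψ, Complex.ofReal_mul, hx, Finset.mul_sum]
    refine Finset.sum_congr rfl fun i hi => ?_
    have hi' : ev i = S.ev k := by simpa [s] using hi
    rw [hi', hilbertBasis_apply]
    ring
  rw [hsum]
  refine hasSum_sum_of_ne_finset_zero fun i hi => ?_
  rw [← S.hilbertBasis_apply, hzero i hi, mul_zero]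

theorem hasSum_heatKernel (t : ℝ≥0) (x : D.Z) (u : LocallyConstant D.Z ℂ) :
    HasSum (fun i => (Real.exp (S.ev i * t) * S.ψ i x : ℝ) * ∫ y, (S.ψ i y : ℂ) * u y ∂D.haar)
      (S.heatKernel t x u) := by
  have h := S.hasSum_heatKernel_eigenbasis S.isEigenbasis
    (fun i => (S.hilbertBasis_apply i).symm) t x u
  simpa using h

end EigenSystem

end PadicGraph

end

theorem corollary3p6 {p : ℕ} [Fact p.Prime] {V : Type*} [Finite V] (D : PadicGraph p V)
    (α : ℝ) (hα : 1 ≤ α) (b : InteractionType) :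
    ∃ K : ℝ≥0 → D.Z → D.Distribution,
      -- `K` is the (unique) heat kernel
      D.IsHeatKernel α b K ∧ (∀ K', D.IsHeatKernel α b K' → K' = K) ∧
      -- the expansion in a suitable orthonormal basis of real valued eigenfunctions
      (∃ (ι : Type) (e : HilbertBasis ι ℂ D.L2) (ev : ι → ℝ) (ψ : ι → LocallyConstant D.Z ℝ),
        IsEigenbasis (D.parisiL2 α b) e ev ∧ (∀ i, D.toL2 (D.complexify (ψ i)) = e i) ∧
        ∀ (t : ℝ≥0) (x : D.Z) (u : LocallyConstant D.Z ℂ),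
          HasSum (fun i => (Real.exp (ev i * t) * ψ i x : ℝ) * ∫ y, (ψ i y : ℂ) * u y ∂D.haar)
            (K t x u)) ∧
      -- the expansion in an arbitrary orthonormal basis of eigenfunctions
      ∀ {ι : Type*} (e : HilbertBasis ι ℂ D.L2) (ev : ι → ℝ),
        IsEigenbasis (D.parisiL2 α b) e ev →
          (D.parisiL2 α b).spec = Set.range (fun i => (ev i : ℂ)) ∧
          (∀ i, ev i ≤ 0) ∧ (∀ c : ℝ, {i | ev i = c}.Finite) ∧
          ∃ ψ : ι → LocallyConstant D.Z ℂ, (∀ i, D.toL2 (ψ i) = e i) ∧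
            ∀ (t : ℝ≥0) (x : D.Z) (u : LocallyConstant D.Z ℂ),
              HasSum (fun i => (Real.exp (ev i * t) : ℂ) * ψ i x *
                  ∫ y, conj (ψ i y) * u y ∂D.haar)
                (K t x u) := by
  obtain ⟨ι, ⟨S⟩⟩ := D.exists_eigenSystem α b hα
  refine ⟨S.heatKernel, S.isHeatKernel, fun _ => S.eq_heatKernel,
    ⟨ι, S.hilbertBasis, S.ev, S.ψ, S.isEigenbasis, fun i => (S.hilbertBasis_apply i).symm,
      S.hasSum_heatKernel⟩, fun e ev he => ⟨?_, ?_, S.finite_eigenbasis_eq he,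
      S.representative e ev, S.toL2_representative he,
      S.hasSum_heatKernel_eigenbasis he (S.toL2_representative he)⟩⟩
  · rw [S.spec_eq, Set.range_comp' Complex.ofReal S.ev, Set.range_comp' Complex.ofReal ev,
      S.range_eq he]
  · intro i
    obtain ⟨j, hj⟩ : ev i ∈ Set.range S.ev := S.range_eq he ▸ ⟨i, rfl⟩
    exact hj ▸ S.ev_nonpos j
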